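/- **Theorem (IO vs OI).** *Definitions.* Simple types are generated by a ground type $o$ and $\to$; $\mathrm{order}(o)=0$ and $\mathrm{order}(\tau_1\to\tau_2)=\max(\mathrm{order}(\tau_1)+1,\mathrm{order}(\tau_2))$. A higher-order recursion scheme $G$ consists of a finite set $\Sigma$ of terminals (each of a type $o\to\cdots\to o\to o$), a finite set of typed non-terminals, an initial non-terminal $S:o$, and for each non-terminal $F:\tau_1\to\cdots\to\tau_k\to o$ exactly one rule $F\,x_1\cdots x_k\to e$, where $e$ is an applicative term of type $o$ over the terminals, the non-terminals and the variables $x_1:\tau_1,\dots,x_k:\tau_k$. The order of $G$ is the largest order of the type of a non-terminal. A redex is a term $F\,t_1\cdots t_k$ of type $o$ with $F$ a non-terminal. A rewriting step replaces, in any context, a redex $F\,t_1\cdots t_k$ by $e[x_1\mapsto t_1,\dots,x_k\mapsto t_k]$; it is an IO (innermost-outermost) step if no $t_j$ has a redex as a subterm. For a ground term $t$, the finite tree $t^\bot$ over $\Sigma\uplus\{\bot\}$ is given by $(F\,t_1\cdots t_k)^\bot=\bot$ for $F$ a non-terminal and $(a\,t_1\cdots t_k)^\bot=a\,t_1^\bot\cdots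 t_k^\bot$ for $a\in\Sigma$. Finite and infinite trees are ordered by $T\sqsubseteq T'$ iff every node of $T$ is a node of $T'$ and has in $T$ the label $\bot$ or the same label as in $T'$. The value tree $[\![G]\!]$ (resp. the IO value tree $[\![G]\!]_{IO}$) is the supremum of $t^\bot$ over all terms $t$ reachable from $S$ by arbitrary (resp. by IO) rewriting steps. *Statement.* There is an algorithm (a computable function) which transforms every higher-order recursion scheme $G$ into a higher-order recursion scheme $G''$ with the same terminals and the same order as $G$ such that $$[\![G'']\!]=[\![G'']\!]_{IO}=[\![G]\!]_{IO},$$ where all these suprema exist. That is, the unrestricted value tree of $G''$ is the IO value tree of $G$, and $G''$ is self-correcting: its unrestricted and IO derivations produce the same tree. -/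

import Mathlib

namespace HORS

/-- Simple types over the ground type `o`. -/
inductive Ty : Type
  | o : Ty
  | arr : Ty → Ty → Ty

namespace Ty

/-- The argument types `[τ₁, …, τₖ]` of `τ₁ → ⋯ → τₖ → o`. -/
def args : Ty → List Ty
  | o => []
  | arr a b => a :: args b

/-- The arity `k` of `τ₁ → ⋯ → τₖ → o`. -/
def arity (τ : Ty) : ℕ := τ.args.length

/-- `order o = 0` and `order (τ₁ → τ₂) = max (order τ₁ + 1) (order τ₂)`. -/
def order : Ty → ℕ
  | o => 0
  | arr a b => max (order a + 1) (order b)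

/-- The type `o → ⋯ → o → o` with `k` arguments. These are exactly the types of order at most `1`. -/
def ofArity : ℕ → Ty
  | 0 => o
  | k + 1 => arr o (ofArity k)

/-- Gödel numbering of types. -/
def toNat : Ty → ℕ
  | o => 0
  | arr a b => Nat.pair (toNat a) (toNat b) + 1

/-- Inverse of `Ty.toNat`. -/
def ofNat : ℕ → Ty
  | 0 => o
  | n + 1 =>
    have := Nat.unpair_left_le n
    have := Nat.unpair_right_le n
    arr (ofNat n.unpair.1) (ofNat n.unpair.2)

theorem ofNat_toNat (τ : Ty) : ofNat (toNat τ) = τ := by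
  induction τ with
  | o => simp [toNat, ofNat]
  | arr a b iha ihb => simp [toNat, ofNat, iha, ihb]

theorem toNat_ofNat (n : ℕ) : toNat (ofNat n) = n := by
  induction n using Nat.strong_induction_on with
  | _ n ih =>
    cases n with
    | zero => simp [toNat, ofNat]
    | succ n =>
      have h1 := Nat.unpair_left_le n
      have h2 := Nat.unpair_right_le n
      rw [ofNat, toNat, ih _ (by omega), ih _ (by omega), Nat.pair_unpair]

/-- Types are in effective bijection with the natural numbers. -/
def equivNat : Ty ≃ ℕ := ⟨toNat, ofNat, ofNat_toNat, toNat_ofNat⟩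

instance : Primcodable Ty := Primcodable.ofEquiv ℕ equivNat

end Ty

/-- A terminal symbol. It has a name and an arity `k`, and its type is `o → ⋯ → o → o`
with `k` arguments. -/
@[ext] structure Terminal : Type where
  name : ℕ
  arity : ℕ

namespace Terminal

/-- The type of a terminal symbol. -/
def type (a : Terminal) : Ty := Ty.ofArity a.arity

/-- A terminal symbol is a pair of natural numbers. -/
def equivProd : Terminal ≃ ℕ × ℕ :=
  ⟨fun a => (a.name, a.arity), fun p => ⟨p.1, p.2⟩, fun _ => rfl, fun _ => rfl⟩

instance : Primcodable Terminal := Primcodable.ofEquiv (ℕ × ℕ) equivProd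

end Terminal

/-- Applicative (not yet typed) terms. A non-terminal is represented by its position in the list of
non-terminals of a scheme, and the variable `xᵢ₊₁` of a rule `F x₁ … xₖ → e` by its position `i`. -/
inductive Term : Type
  | terminal : Terminal → Term
  | nonterminal : ℕ → Term
  | var : ℕ → Term
  | app : Term → Term → Term

namespace Term

/-- Gödel numbering of terms. -/
def toNat : Term → ℕ
  | terminal a => 4 * Nat.pair a.name a.arity
  | nonterminal F => 4 * F + 1
  | var i => 4 * i + 2
  | app t s => 4 * Nat.pair (toNat t) (toNat s) + 3

/-- Inverse of `Term.toNat`. -/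
def ofNat (n : ℕ) : Term :=
  if n % 4 = 0 then terminal ⟨(n / 4).unpair.1, (n / 4).unpair.2⟩
  else if n % 4 = 1 then nonterminal (n / 4)
  else if n % 4 = 2 then var (n / 4)
  else
    have := Nat.unpair_left_le (n / 4)
    have := Nat.unpair_right_le (n / 4)
    app (ofNat (n / 4).unpair.1) (ofNat (n / 4).unpair.2)
termination_by n
decreasing_by all_goals omega

theorem ofNat_toNat (t : Term) : ofNat (toNat t) = t := by
  induction t with
  | terminal a => rw [ofNat]; simp [toNat]
  | nonterminal F =>
    rw [ofNat, toNat, if_neg (by omega), if_pos (by omega), show (4 * F + 1) / 4 = F by omega]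
  | var i =>
    rw [ofNat, toNat, if_neg (by omega), if_neg (by omega), if_pos (by omega),
      show (4 * i + 2) / 4 = i by omega]
  | app t s iht ihs =>
    rw [ofNat, toNat, if_neg (by omega), if_neg (by omega), if_neg (by omega),
      show ∀ m, (4 * m + 3) / 4 = m by intro m; omega]
    simp [iht, ihs]

theorem toNat_ofNat (n : ℕ) : toNat (ofNat n) = n := by
  induction n using Nat.strong_induction_on with
  | _ n ih =>
    have h1 := Nat.unpair_left_le (n / 4)
    have h2 := Nat.unpair_right_le (n / 4)
    rw [ofNat]
    split_ifs with c0 c1 c2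
    · simp only [toNat, Nat.pair_unpair]; omega
    · simp only [toNat]; omega
    · simp only [toNat]; omega
    · simp only [toNat]
      rw [ih _ (by omega), ih _ (by omega), Nat.pair_unpair]; omega

/-- Terms are in effective bijection with the natural numbers. -/
def equivNat : Term ≃ ℕ := ⟨toNat, ofNat, ofNat_toNat, toNat_ofNat⟩

instance : Primcodable Term := Primcodable.ofEquiv ℕ equivNat

/-- `t.HasType Sig N X τ`: `t` is a term of type `τ` over the terminals in `Sig`, the non-terminals
with types `N` and the variables with types `X`. -/
inductive HasType (Sig : List Terminal) (N X : List Ty) : Term → Ty → Prop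
  | terminal {a : Terminal} : a ∈ Sig → HasType Sig N X (terminal a) a.type
  | nonterminal {F : ℕ} {τ : Ty} : N[F]? = some τ → HasType Sig N X (nonterminal F) τ
  | var {i : ℕ} {τ : Ty} : X[i]? = some τ → HasType Sig N X (var i) τ
  | app {t s : Term} {σ τ : Ty} :
      HasType Sig N X t (Ty.arr σ τ) → HasType Sig N X s σ → HasType Sig N X (app t s) τ

/-- The iterated application `t t₁ … tₖ`. -/
def apps (t : Term) (ts : List Term) : Term := ts.foldl app t

/-- The simultaneous substitution `t[x₁ ↦ t₁, …, xₖ ↦ tₖ]` for `ts = [t₁, …, tₖ]`. -/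
def subst (ts : List Term) : Term → Term
  | terminal a => terminal a
  | nonterminal F => nonterminal F
  | var i => ts.getD i (var i)
  | app t s => app (subst ts t) (subst ts s)

/-- `r.Subterm t`: the term `r` is a subterm of `t`. -/
inductive Subterm (r : Term) : Term → Prop
  | refl : Subterm r r
  | left {t s : Term} : Subterm r t → Subterm r (app t s)
  | right {t s : Term} : Subterm r s → Subterm r (app t s)

end Term

/-- The raw data of a recursion scheme: the terminals, for each non-terminal `F` its type together
with the right-hand side `e` of its rule `F x₁ … xₖ → e`, and the initial non-terminal. -/
structure Scheme : Type where
  terminals : List Terminal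
  rules : List (Ty × Term)
  start : ℕ

namespace Scheme

/-- A scheme is a triple of finite data. -/
def equivProd : Scheme ≃ List Terminal × List (Ty × Term) × ℕ :=
  ⟨fun G => (G.terminals, G.rules, G.start), fun p => ⟨p.1, p.2.1, p.2.2⟩,
    fun _ => rfl, fun _ => rfl⟩

instance : Primcodable Scheme :=
  Primcodable.ofEquiv (List Terminal × List (Ty × Term) × ℕ) equivProd

/-- The types of the non-terminals. -/
def types (G : Scheme) : List Ty := G.rules.map Prod.fst

/-- `G` is a higher-order recursion scheme: the right-hand side of the rule of each
`F : τ₁ → ⋯ → τₖ → o` is a term of ground type over the terminals, the non-terminals and the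
variables `x₁ : τ₁, …, xₖ : τₖ`, and the initial non-terminal has ground type. -/
structure IsHORS (G : Scheme) : Prop where
  body : ∀ p ∈ G.rules, p.2.HasType G.terminals G.types p.1.args Ty.o
  start : G.types[G.start]? = some Ty.o

/-- The order of a scheme: the largest order of the type of a non-terminal. -/
def order (G : Scheme) : ℕ := (G.types.map Ty.order).foldr max 0

/-- `G.Contracts F ts e`: `F t₁ … tₖ` with `ts = [t₁, …, tₖ]` is a fully applied non-terminal, and
`F x₁ … xₖ → e` is the rule of `F`. -/
def Contracts (G : Scheme) (F : ℕ) (ts : List Term) (e : Term) : Prop :=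
  ∃ τ : Ty, G.rules[F]? = some (τ, e) ∧ ts.length = τ.arity

/-- A redex is a fully applied non-terminal `F t₁ … tₖ`, that is, for a well-typed term, one of
ground type. -/
def IsRedex (G : Scheme) (t : Term) : Prop :=
  ∃ F ts e, G.Contracts F ts e ∧ t = (Term.nonterminal F).apps ts

/-- The rewriting relation: a redex `F t₁ … tₖ` in any context is replaced by
`e[x₁ ↦ t₁, …, xₖ ↦ tₖ]`. -/
inductive Step (G : Scheme) : Term → Term → Prop
  | redex {F : ℕ} {ts : List Term} {e : Term} :
      G.Contracts F ts e → Step G ((Term.nonterminal F).apps ts) (e.subst ts)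
  | left {t t' s : Term} : Step G t t' → Step G (Term.app t s) (Term.app t' s)
  | right {t s s' : Term} : Step G s s' → Step G (Term.app t s) (Term.app t s')

/-- Innermost-outermost rewriting: the contracted redex `F t₁ … tₖ` has no redex among the subterms
of its arguments. -/
inductive InnermostStep (G : Scheme) : Term → Term → Prop
  | redex {F : ℕ} {ts : List Term} {e : Term} :
      G.Contracts F ts e → (∀ s ∈ ts, ∀ r : Term, r.Subterm s → ¬ G.IsRedex r) →
      InnermostStep G ((Term.nonterminal F).apps ts) (e.subst ts)
  | left {t t' s : Term} : InnermostStep G t t' → InnermostStep G (Term.app t s) (Term.app t' s)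
  | right {t s s' : Term} : InnermostStep G s s' → InnermostStep G (Term.app t s) (Term.app t s')

/-- The terms accessible by unrestricted derivations. -/
def Acc (G : Scheme) : Set Term :=
  {t | Relation.ReflTransGen G.Step (Term.nonterminal G.start) t}

/-- The terms accessible by innermost-outermost derivations. -/
def InnermostAcc (G : Scheme) : Set Term :=
  {t | Relation.ReflTransGen G.InnermostStep (Term.nonterminal G.start) t}

end Scheme

/-- A finite or infinite ranked tree with nodes labelled by terminals or by `⊥`. A node is the list
of directions leading to it, with the `k` children of a node numbered `0, …, k - 1`. The value
`label u` is `none` if `u` is not a node, `some none` if `u` is a node labelled `⊥`, and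
`some (some a)` if `u` is a node labelled by the terminal `a`. -/
@[ext] structure Tree : Type where
  label : List ℕ → Option (Option Terminal)
  root : label [] ≠ none
  child : ∀ (u : List ℕ) (j : ℕ),
    label (u ++ [j]) ≠ none ↔ ∃ a : Terminal, label u = some (some a) ∧ j < a.arity

namespace Tree

/-- `T ⊑ T'`: every node of `T` is a node of `T'`, and has label `⊥` in `T` or the same label in
both trees. -/
instance : PartialOrder Tree where
  le T T' := ∀ u, T.label u ≠ none →
    T'.label u ≠ none ∧ (T.label u = some none ∨ T.label u = T'.label u)
  le_refl T u hu := ⟨hu, Or.inr rfl⟩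
  le_trans T₁ T₂ T₃ h₁ h₂ u hu := by
    obtain ⟨k₁, e₁⟩ := h₁ u hu
    obtain ⟨k₂, e₂⟩ := h₂ u k₁
    refine ⟨k₂, ?_⟩
    rcases e₁ with e₁ | e₁
    · exact Or.inl e₁
    · rw [e₁]; exact e₂
  le_antisymm T₁ T₂ h₁ h₂ := by
    ext1
    funext u
    by_cases hu : T₁.label u = none
    · by_cases hv : T₂.label u = none
      · rw [hu, hv]
      · exact absurd hu (h₂ u hv).1
    · obtain ⟨k₁, e₁⟩ := h₁ u hu
      obtain ⟨-, e₂⟩ := h₂ u k₁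
      rcases e₁ with e₁ | e₁
      · rcases e₂ with e₂ | e₂
        · rw [e₁, e₂]
        · exact e₂.symm
      · exact e₁

/-- The one-node tree `⊥`. -/
def bot : Tree where
  label u := if u = [] then some none else none
  root := by simp
  child u j := by
    by_cases hu : u = [] <;> simp [hu]

/-- The tree with root `a` and immediate subtrees given by `c`. -/
def node (a : Terminal) (c : ℕ → Tree) : Tree where
  label
    | [] => some (some a)
    | i :: u => if i < a.arity then (c i).label u else none
  root := by simp
  child u j := by
    cases u with
    | nil =>
      by_cases hj : j < a.arity
      · simpa [hj] using (c j).root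
      · simp [hj]
    | cons i u =>
      by_cases hi : i < a.arity
      · simpa [hi] using (c i).child u j
      · simp [hi]

end Tree

/-- The `⊥`-transformation of `t t₁ … tₖ`, where `ts` lists the transforms of `t₁, …, tₖ`. -/
def Term.botTransformAux : Term → List Tree → Tree
  | Term.terminal a, ts => Tree.node a (fun i => ts.getD i Tree.bot)
  | Term.nonterminal _, _ => Tree.bot
  | Term.var _, _ => Tree.bot
  | Term.app t s, ts => botTransformAux t (botTransformAux s [] :: ts)

/-- The `⊥`-transformation `t^⊥` of a ground term, given by `(F t₁ … tₖ)^⊥ = ⊥` for a non-terminal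
`F` and `(a t₁ … tₖ)^⊥ = a t₁^⊥ … tₖ^⊥` for a terminal `a`. -/
def Term.botTransform (t : Term) : Tree := t.botTransformAux []

namespace Scheme

/-- `T` is the value tree of `G`: the supremum of the `⊥`-transforms of the terms accessible by
unrestricted derivations. -/
def IsValueTree (G : Scheme) (T : Tree) : Prop :=
  IsLUB (Term.botTransform '' G.Acc) T

/-- `T` is the value tree of `G` for innermost-outermost derivations. -/
def IsInnermostValueTree (G : Scheme) (T : Tree) : Prop :=
  IsLUB (Term.botTransform '' G.InnermostAcc) T

end Scheme

end HORS

/-!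
An innermost-outermost derivation contracts `F t₁ … tₖ` only when the arguments `t₁, …, tₖ` are
normal, so a redex with an argument that has no normal form stays `⊥` forever. An unrestricted
derivation discards such arguments or goes on without evaluating them. The self-correcting scheme
knows which arguments diverge, and replaces by `Ω` (with the rule `Ω → Ω`) the redexes that are
blocked for this reason.

*The model.* Convergence of terms, that is, the existence of an innermost-outermost normal form, is
described by a finite call-by-value model. A term of type `τ` has a code below `Ty.card τ`, which
says whether it converges by itself and whether it still does when it is applied to arguments with
given codes. The codes of the non-terminals are the least fixpoint, computed by iteration from the
bottom (`Scheme.codes`). Not every code is a monotone function, so the iteration is only compared on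
the hereditarily monotone codes (`Good`, `Le`), and these include the codes of all closed terms. Being a
fixpoint, the interpretation is invariant under innermost-outermost steps
(`Scheme.InnermostStep.code_eq`). Being the least one, it is adequate: a logical relation shows that
a term whose code says so has a normal form (`Scheme.exists_normal`).

*The scheme.* A term of type `τ₁ → ⋯ → τₖ → o` gets one version for each tuple of codes for its
arguments, and an argument is passed on in all its versions (`Term.versions`). As every type has at
least one version, the order does not change. The number of a version of a non-terminal `F` tells
whether all the arguments of `F` converge, and accordingly its right-hand side is a version of the
right-hand side of `F`, or `Ω` (`Scheme.versionBody`). The arguments of a terminal are derived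
independently of each other, even if some of them diverge; all versions of a terminal are the
terminal itself. This is why the versions also range over codes of diverging arguments: whether
such an argument blocks `x t₁ … tₖ` depends on what the variable `x` stands for.

*Correctness.* Each innermost-outermost step of `G` is simulated in the versions of the term by
innermost-outermost derivations of the new scheme (`Scheme.InnermostStep.lift`). Conversely, suppose
that `n` parallel reductions lead from a version of a term to `q`. Then `q` does not produce more
than some term which `G` reaches by innermost-outermost steps (`Scheme.exists_innermost_ge`). This
is shown by induction on `n` and on the term. If all arguments of a redex converge, they have normal
forms by adequacy. The derivation to these normal forms can be carried out first, since parallel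
reduction is confluent, and contracting the redex then uses up one of the `n` reductions. Hence the
three sets of trees in question have the same upper bounds. A supremum exists because derivations
are joinable (`Scheme.exists_innermostValueTree`).

*Computability.* Types and terms are handled by structural recursion, which is primitive recursive
in the Gödel numbers (`Ty.primrec_rec`, `Term.primrec_rec`), and the number of rounds of the fixpoint
iteration is bounded explicitly (`Scheme.rounds`).
-/

namespace HORS

open Relation

/-! ### Iterated application -/

namespace Term

theorem apps_concat (t s : Term) (ts : List Term) : t.apps (ts ++ [s]) = app (t.apps ts) s := by
  simp [apps]

theorem apps_append (t : Term) (ts us : List Term) : t.apps (ts ++ us) = (t.apps ts).apps us := by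
  simp [apps]

theorem nonterminal_apps_inj {F F' : ℕ} {ts ts' : List Term}
    (h : (nonterminal F).apps ts = (nonterminal F').apps ts') : F = F' ∧ ts = ts' := by
  induction ts using List.reverseRecOn generalizing ts' with
  | nil =>
    cases ts' using List.reverseRecOn with
    | nil => simpa [apps] using h
    | append_singleton l s => rw [apps_concat] at h; simp [apps] at h
  | append_singleton l s ih =>
    cases ts' using List.reverseRecOn with
    | nil => rw [apps_concat] at h; simp [apps] at h
    | append_singleton l' s' =>
      rw [apps_concat, apps_concat, app.injEq] at h
      obtain ⟨h1, h2⟩ := ih h.1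
      exact ⟨h1, by rw [h2, h.2]⟩

theorem sizeOf_le_apps (t : Term) (ts : List Term) : sizeOf t ≤ sizeOf (t.apps ts) := by
  induction ts generalizing t with
  | nil => simp [apps]
  | cons s ts ih => exact le_trans (by simp; omega) (ih (app t s))

theorem sizeOf_lt_apps {t s : Term} {ts : List Term} (h : s ∈ ts) :
    sizeOf s < sizeOf (t.apps ts) := by
  induction ts generalizing t with
  | nil => simp at h
  | cons s' ts ih =>
    rcases List.mem_cons.1 h with rfl | h
    · exact lt_of_lt_of_le (by simp) (sizeOf_le_apps (app t s) ts)
    · exact ih h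

theorem subst_apps (us : List Term) (t : Term) (ts : List Term) :
    (t.apps ts).subst us = (t.subst us).apps (ts.map (subst us)) := by
  induction ts generalizing t with
  | nil => rfl
  | cons s ts ih => exact ih (app t s)

/-- The head of a term: the atom to which the leftmost chain of applications leads. -/
def head : Term → Term
  | app t _ => head t
  | t => t

theorem head_apps (t : Term) (ts : List Term) : (t.apps ts).head = t.head := by
  induction ts generalizing t with
  | nil => rfl
  | cons s ts ih => exact ih (app t s)

end Term

/-! ### Trees -/

namespace Tree

theorem bot_le (T : Tree) : bot ≤ T := by
  intro u hu
  by_cases h : u = []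
  · subst h; exact ⟨T.root, Or.inl (by simp [bot])⟩
  · simp [bot, h] at hu

theorem node_mono (a : Terminal) {c c' : ℕ → Tree} (h : ∀ i, c i ≤ c' i) :
    node a c ≤ node a c' := by
  intro u hu
  cases u with
  | nil => exact ⟨by simp [node], Or.inr rfl⟩
  | cons i u =>
    by_cases hi : i < a.arity
    · simp only [node, hi, if_true] at hu ⊢
      exact h i u hu
    · simp [node, hi] at hu

/-- A nonempty set of trees that are pairwise compatible has a supremum: a node carries the terminal
that some tree of the set puts there, if there is one. -/
theorem exists_isLUB_of_pairwise {S : Set Tree} (hne : S.Nonempty)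
    (h : ∀ A ∈ S, ∀ B ∈ S, ∃ C, A ≤ C ∧ B ≤ C) : ∃ T, IsLUB S T := by
  classical
  -- Two trees of the set never put different terminals at the same node.
  have huniq : ∀ A ∈ S, ∀ B ∈ S, ∀ u a b, A.label u = some (some a) → B.label u = some (some b) →
      a = b := by
    intro A hA B hB u a b ha hb
    obtain ⟨C, hAC, hBC⟩ := h A hA B hB
    have h1 := (hAC u (by simp [ha])).2
    have h2 := (hBC u (by simp [hb])).2
    rw [ha] at h1; rw [hb] at h2
    simp only [Option.some.injEq, reduceCtorEq, false_or] at h1 h2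
    rw [← h1] at h2
    simpa using h2.symm
  let lab : List ℕ → Option (Option Terminal) := fun u =>
    if h : ∃ a, ∃ A ∈ S, A.label u = some (some a) then some (some h.choose)
    else if ∃ A ∈ S, A.label u ≠ none then some none else none
  have hlab : ∀ u a, lab u = some (some a) ↔ ∃ A ∈ S, A.label u = some (some a) := by
    intro u a
    by_cases hu : ∃ a, ∃ A ∈ S, A.label u = some (some a)
    · have e : lab u = some (some hu.choose) := dif_pos hu
      obtain ⟨A, hA, hAu⟩ := hu.choose_spec
      rw [e]
      constructor
      · intro hh
        rw [Option.some.injEq, Option.some.injEq] at hh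
        exact ⟨A, hA, hh ▸ hAu⟩
      · rintro ⟨B, hB, hBu⟩
        rw [huniq A hA B hB u _ _ hAu hBu]
    · have e : lab u = if ∃ A ∈ S, A.label u ≠ none then some none else none := dif_neg hu
      rw [e]
      constructor
      · split_ifs <;> simp
      · intro hh; exact absurd ⟨a, hh⟩ hu
  have hnone : ∀ u, lab u ≠ none ↔ ∃ A ∈ S, A.label u ≠ none := by
    intro u
    by_cases hu : ∃ a, ∃ A ∈ S, A.label u = some (some a)
    · have e : lab u = some (some hu.choose) := dif_pos hu
      obtain ⟨A, hA, hAu⟩ := hu.choose_spec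
      rw [e]
      exact ⟨fun _ => ⟨A, hA, by simp [hAu]⟩, fun _ => by simp⟩
    · have e : lab u = if ∃ A ∈ S, A.label u ≠ none then some none else none := dif_neg hu
      rw [e]
      split_ifs with h2
      · exact ⟨fun _ => h2, fun _ => by simp⟩
      · simp only [ne_eq, not_true_eq_false, false_iff]; exact h2
  obtain ⟨A₀, hA₀⟩ := hne
  refine ⟨⟨lab, (hnone []).2 ⟨A₀, hA₀, A₀.root⟩, ?_⟩, ?_, ?_⟩
  · intro u j
    rw [hnone]
    constructor
    · rintro ⟨A, hA, hu⟩
      obtain ⟨a, ha, hj⟩ := (A.child u j).1 hu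
      exact ⟨a, (hlab u a).2 ⟨A, hA, ha⟩, hj⟩
    · rintro ⟨a, ha, hj⟩
      obtain ⟨A, hA, ha⟩ := (hlab u a).1 ha
      exact ⟨A, hA, (A.child u j).2 ⟨a, ha, hj⟩⟩
  · intro A hA u hu
    refine ⟨(hnone u).2 ⟨A, hA, hu⟩, ?_⟩
    cases e : A.label u with
    | none => exact absurd e hu
    | some x =>
      cases x with
      | none => exact Or.inl rfl
      | some a => exact Or.inr ((hlab u a).2 ⟨A, hA, e⟩).symm
  · intro B hB u hu
    obtain ⟨A, hA, hAu⟩ := (hnone u).1 hu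
    refine ⟨(hB hA u hAu).1, ?_⟩
    change lab u = some none ∨ lab u = B.label u
    cases e : lab u with
    | none => exact absurd e hu
    | some x =>
      cases x with
      | none => exact Or.inl rfl
      | some a =>
        obtain ⟨A', hA', e'⟩ := (hlab u a).1 e
        have := (hB hA' u (by simp [e'])).2
        rw [e'] at this
        simp only [Option.some.injEq, reduceCtorEq, false_or] at this
        exact Or.inr this

end Tree

/-! ### Parallel reduction and confluence -/

namespace Scheme

/-- Parallel reduction: any set of redexes that are present in the term is contracted at once. -/
inductive Par (G : Scheme) : Term → Term → Prop
  | refl (t : Term) : Par G t t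
  | app {t t' s s' : Term} : Par G t t' → Par G s s' → Par G (Term.app t s) (Term.app t' s')
  | redex {F : ℕ} {ts ts' : List Term} {e : Term} : G.Contracts F ts e →
      List.Forall₂ (Par G) ts ts' → Par G ((Term.nonterminal F).apps ts) (e.subst ts')

variable {G : Scheme}

theorem forall₂_par_refl (ts : List Term) : List.Forall₂ G.Par ts ts :=
  List.forall₂_same.2 fun t _ => Par.refl t

theorem Par.apps {t t' : Term} {ts ts' : List Term} (h : G.Par t t')
    (hs : List.Forall₂ G.Par ts ts') : G.Par (t.apps ts) (t'.apps ts') := by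
  induction hs generalizing t t' with
  | nil => exact h
  | cons h1 _ ih => exact ih (Par.app h h1)

theorem getD_forall₂ {α β : Type*} {R : α → β → Prop} {l : List α} {l' : List β}
    (h : List.Forall₂ R l l') {a : α} {b : β} (hab : R a b) (i : ℕ) :
    R (l.getD i a) (l'.getD i b) := by
  induction h generalizing i with
  | nil => simpa using hab
  | cons h1 _ ih =>
    cases i with
    | zero => simpa using h1
    | succ i => simpa using ih i

theorem Par.subst {ts ts' : List Term} (h : List.Forall₂ G.Par ts ts') (e : Term) :
    G.Par (e.subst ts) (e.subst ts') := by
  induction e with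
  | terminal a => exact Par.refl _
  | nonterminal F => exact Par.refl _
  | var i => exact getD_forall₂ h (Par.refl _) i
  | app t s iht ihs => exact Par.app iht ihs

/-- A non-terminal that has at most as many arguments as its arity reduces in its arguments or is
contracted. -/
theorem Par.inv_apps {F : ℕ} {ts : List Term} {q : Term}
    (hF : ∀ τ e, G.rules[F]? = some (τ, e) → ts.length ≤ τ.arity)
    (h : G.Par ((Term.nonterminal F).apps ts) q) :
    (∃ ts', List.Forall₂ G.Par ts ts' ∧ q = (Term.nonterminal F).apps ts') ∨
      ∃ e ts', G.Contracts F ts e ∧ List.Forall₂ G.Par ts ts' ∧ q = e.subst ts' := by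
  induction ts using List.reverseRecOn generalizing q with
  | nil =>
    generalize ht : (Term.nonterminal F).apps [] = t at h
    cases h with
    | refl => exact Or.inl ⟨[], List.Forall₂.nil, ht.symm⟩
    | app => simp [Term.apps] at ht
    | redex hc hs =>
      obtain ⟨rfl, rfl⟩ := Term.nonterminal_apps_inj ht
      exact Or.inr ⟨_, _, hc, hs, rfl⟩
  | append_singleton l s ih =>
    generalize ht : (Term.nonterminal F).apps (l ++ [s]) = t at h
    cases h with
    | refl => exact Or.inl ⟨_, forall₂_par_refl _, ht.symm⟩
    | app h1 h2 =>
      rw [Term.apps_concat, Term.app.injEq] at ht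
      obtain ⟨rfl, rfl⟩ := ht
      have hlen : ∀ τ e, G.rules[F]? = some (τ, e) → l.length < τ.arity := by
        intro τ e he
        have := hF τ e he
        simp at this; omega
      rcases ih (fun τ e he => (hlen τ e he).le) h1 with ⟨ts', hs, rfl⟩ | ⟨e, ts', ⟨τ, he, hl⟩, -, -⟩
      · refine Or.inl ⟨ts' ++ [_], List.rel_append hs (List.Forall₂.cons h2 List.Forall₂.nil), ?_⟩
        rw [Term.apps_concat]
      · exact absurd hl (hlen τ e he).ne
    | redex hc hs =>
      obtain ⟨rfl, rfl⟩ := Term.nonterminal_apps_inj ht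
      exact Or.inr ⟨_, _, hc, hs, rfl⟩

theorem Contracts.length_le {F : ℕ} {ts : List Term} {e : Term} (h : G.Contracts F ts e) :
    ∀ τ e, G.rules[F]? = some (τ, e) → ts.length ≤ τ.arity := by
  obtain ⟨τ, he, hl⟩ := h
  intro τ' e' he'
  rw [he] at he'
  cases he'
  exact hl.le

theorem Contracts.unique {F : ℕ} {ts ts' : List Term} {e e' : Term} (h : G.Contracts F ts e)
    (h' : G.Contracts F ts' e') : e = e' := by
  obtain ⟨τ, he, -⟩ := h
  obtain ⟨τ', he', -⟩ := h'
  rw [he] at he'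
  cases he'
  rfl

theorem Contracts.congr {F : ℕ} {ts ts' : List Term} {e : Term} (h : G.Contracts F ts e)
    (hl : ts'.length = ts.length) : G.Contracts F ts' e := by
  obtain ⟨τ, he, h⟩ := h
  exact ⟨τ, he, hl.trans h⟩

theorem forall₂_join {ts as bs : List Term}
    (H : ∀ t ∈ ts, ∀ p q, G.Par t p → G.Par t q → ∃ r, G.Par p r ∧ G.Par q r)
    (ha : List.Forall₂ G.Par ts as) (hb : List.Forall₂ G.Par ts bs) :
    ∃ cs, List.Forall₂ G.Par as cs ∧ List.Forall₂ G.Par bs cs := by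
  induction ha generalizing bs with
  | nil => cases hb; exact ⟨[], .nil, .nil⟩
  | cons h1 _ ih =>
    cases hb with
    | cons h2 hb =>
      obtain ⟨r, hr1, hr2⟩ := H _ (by simp) _ _ h1 h2
      obtain ⟨cs, hc1, hc2⟩ := ih (fun t ht => H t (by simp [ht])) hb
      exact ⟨r :: cs, .cons hr1 hc1, .cons hr2 hc2⟩

theorem Par.diamond {t p q : Term} (hp : G.Par t p) (hq : G.Par t q) :
    ∃ r, G.Par p r ∧ G.Par q r := by
  induction hn : sizeOf t using Nat.strong_induction_on generalizing t p q with
  | _ n ih =>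
    subst hn
    -- The case in which one of the two reductions contracts the term itself.
    have hredex : ∀ F ts e ts' q, t = (Term.nonterminal F).apps ts → G.Contracts F ts e →
        List.Forall₂ G.Par ts ts' → G.Par t q → ∃ r, G.Par (e.subst ts') r ∧ G.Par q r := by
      rintro F ts e ts' q rfl hc hs hq
      have H : ∀ s ∈ ts, ∀ p q, G.Par s p → G.Par s q → ∃ r, G.Par p r ∧ G.Par q r :=
        fun s hs p q h1 h2 => ih _ (Term.sizeOf_lt_apps hs) h1 h2 rfl
      rcases hq.inv_apps hc.length_le with ⟨us, hu, rfl⟩ | ⟨e', us, hc', hu, rfl⟩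
      · obtain ⟨cs, h1, h2⟩ := forall₂_join H hs hu
        exact ⟨_, Par.subst h1 e, Par.redex (hc.congr hu.length_eq.symm) h2⟩
      · obtain ⟨cs, h1, h2⟩ := forall₂_join H hs hu
        rw [hc'.unique hc]
        exact ⟨_, Par.subst h1 e, Par.subst h2 e⟩
    cases hp with
    | refl => exact ⟨q, hq, .refl q⟩
    | redex hc hs => exact hredex _ _ _ _ _ rfl hc hs hq
    | @app t t' s s' h1 h2 =>
      generalize ht : Term.app t s = t0 at hq
      cases hq with
      | refl => subst ht; exact ⟨_, .refl _, .app h1 h2⟩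
      | redex hc hs =>
        obtain ⟨r, hr1, hr2⟩ := hredex _ _ _ _ _ ht hc hs (.app h1 h2)
        exact ⟨r, hr2, hr1⟩
      | app h3 h4 =>
        rw [Term.app.injEq] at ht
        obtain ⟨rfl, rfl⟩ := ht
        obtain ⟨r, hr1, hr2⟩ := ih _ (by simp; omega) h1 h3 rfl
        obtain ⟨r', hr1', hr2'⟩ := ih _ (by simp) h2 h4 rfl
        exact ⟨_, .app hr1 hr1', .app hr2 hr2'⟩

theorem Par.strip {t p q : Term} (hp : G.Par t p) (hq : ReflTransGen G.Par t q) :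
    ∃ r, ReflTransGen G.Par p r ∧ G.Par q r := by
  induction hq with
  | refl => exact ⟨p, .refl, hp⟩
  | tail _ h ih =>
    obtain ⟨r, h1, h2⟩ := ih
    obtain ⟨r', h3, h4⟩ := h2.diamond h
    exact ⟨r', h1.tail h3, h4⟩

/-- `n` consecutive parallel reductions. -/
def ParN (G : Scheme) : ℕ → Term → Term → Prop
  | 0, t, q => t = q
  | n + 1, t, q => ∃ p, G.Par t p ∧ ParN G n p q

theorem ParN.strip {n : ℕ} {t p q : Term} (hp : G.ParN n t p) (hq : ReflTransGen G.Par t q) :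
    ∃ r, ReflTransGen G.Par p r ∧ G.ParN n q r := by
  induction n generalizing t q with
  | zero => cases hp; exact ⟨q, hq, rfl⟩
  | succ n ih =>
    obtain ⟨t', h1, h2⟩ := hp
    obtain ⟨q', h3, h4⟩ := h1.strip hq
    obtain ⟨r, h5, h6⟩ := ih h2 h3
    exact ⟨r, h5, q', h4, h6⟩

theorem confluent {t p q : Term} (hp : ReflTransGen G.Par t p) (hq : ReflTransGen G.Par t q) :
    ∃ r, ReflTransGen G.Par p r ∧ ReflTransGen G.Par q r := by
  induction hp with
  | refl => exact ⟨q, hq, .refl⟩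
  | tail _ h ih =>
    obtain ⟨r, h1, h2⟩ := ih
    obtain ⟨r', h3, h4⟩ := h.strip h1
    exact ⟨r', h3, h2.tail h4⟩

theorem exists_parN {t q : Term} (h : ReflTransGen G.Par t q) : ∃ n, G.ParN n t q := by
  induction h using ReflTransGen.head_induction_on with
  | refl => exact ⟨0, rfl⟩
  | head h1 _ ih => obtain ⟨n, hn⟩ := ih; exact ⟨n + 1, _, h1, hn⟩

theorem Step.par {t q : Term} (h : G.Step t q) : G.Par t q := by
  induction h with
  | redex hc => exact .redex hc (forall₂_par_refl _)
  | left _ ih => exact .app ih (.refl _)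
  | right _ ih => exact .app (.refl _) ih

theorem InnermostStep.step {t q : Term} (h : G.InnermostStep t q) : G.Step t q := by
  induction h with
  | redex hc _ => exact .redex hc
  | left _ ih => exact .left ih
  | right _ ih => exact .right ih

theorem InnermostStep.par {t q : Term} (h : G.InnermostStep t q) : G.Par t q := h.step.par

theorem innermost_left {t t' : Term} (h : ReflTransGen G.InnermostStep t t') (s : Term) :
    ReflTransGen G.InnermostStep (.app t s) (.app t' s) :=
  h.lift (fun t => Term.app t s) fun _ _ h => .left h

theorem innermost_right {s s' : Term} (h : ReflTransGen G.InnermostStep s s') (t : Term) :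
    ReflTransGen G.InnermostStep (.app t s) (.app t s') :=
  h.lift (fun s => Term.app t s) fun _ _ h => .right h

theorem innermost_app {t t' s s' : Term} (h : ReflTransGen G.InnermostStep t t')
    (h' : ReflTransGen G.InnermostStep s s') :
    ReflTransGen G.InnermostStep (.app t s) (.app t' s') :=
  (innermost_left h s).trans (innermost_right h' t')

theorem innermost_apps {t t' : Term} {ts ts' : List Term} (h : ReflTransGen G.InnermostStep t t')
    (hs : List.Forall₂ (ReflTransGen G.InnermostStep) ts ts') :
    ReflTransGen G.InnermostStep (t.apps ts) (t'.apps ts') := by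
  induction hs generalizing t t' with
  | nil => exact h
  | cons h1 _ ih => exact ih (innermost_app h h1)

/-! ### Reduction and the `⊥`-transformation -/

theorem botTransformAux_of_head {t : Term} {F : ℕ} (h : t.head = .nonterminal F) (ts : List Tree) :
    t.botTransformAux ts = Tree.bot := by
  induction t generalizing ts with
  | app t s iht _ => exact iht h _
  | terminal a => simp [Term.head] at h
  | nonterminal F => rfl
  | var i => rfl

theorem botTransformAux_mono (t : Term) {ts ts' : List Tree}
    (h : List.Forall₂ (· ≤ ·) ts ts') : t.botTransformAux ts ≤ t.botTransformAux ts' := by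
  induction t generalizing ts ts' with
  | terminal a => exact Tree.node_mono a fun i => getD_forall₂ h le_rfl i
  | nonterminal F => exact le_rfl
  | var i => exact le_rfl
  | app t s iht _ => exact iht (.cons le_rfl h)

theorem Par.botTransformAux_le {t q : Term} (h : G.Par t q) {ts ts' : List Tree}
    (hs : List.Forall₂ (· ≤ ·) ts ts') : t.botTransformAux ts ≤ q.botTransformAux ts' := by
  obtain ⟨n, hn⟩ : ∃ n, n = sizeOf t := ⟨_, rfl⟩
  induction n using Nat.strong_induction_on generalizing t q ts ts' with
  | _ n ih =>
    cases h with
    | refl => exact botTransformAux_mono _ hs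
    | app h1 h2 =>
      simp only [Term.app.sizeOf_spec] at hn
      exact ih _ (by omega) h1 (.cons (ih _ (by omega) h2 .nil rfl) hs) rfl
    | redex hc _ =>
      rw [botTransformAux_of_head (Term.head_apps _ _)]
      exact Tree.bot_le _

theorem botTransformAux_le_of_par {t q : Term} (h : ReflTransGen G.Par t q) {ts ts' : List Tree}
    (hs : List.Forall₂ (· ≤ ·) ts ts') : t.botTransformAux ts ≤ q.botTransformAux ts' := by
  induction h with
  | refl => exact botTransformAux_mono _ hs
  | tail _ h ih =>
    exact ih.trans (h.botTransformAux_le (List.forall₂_same.2 fun _ _ => le_rfl))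

/-- The innermost-outermost value tree exists, because any two derivations are joinable. -/
theorem exists_innermostValueTree (G : Scheme) : ∃ T, G.IsInnermostValueTree T := by
  refine Tree.exists_isLUB_of_pairwise ⟨_, _, ReflTransGen.refl, rfl⟩ ?_
  rintro _ ⟨t, ht, rfl⟩ _ ⟨s, hs, rfl⟩
  have H : ∀ {t}, t ∈ G.InnermostAcc → ReflTransGen G.Par (.nonterminal G.start) t :=
    fun h => ReflTransGen.mono (r := G.InnermostStep) (fun _ _ h => h.par) _ _ h
  obtain ⟨r, h1, h2⟩ := confluent (H ht) (H hs)
  exact ⟨r.botTransform, botTransformAux_le_of_par h1 .nil, botTransformAux_le_of_par h2 .nil⟩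

end Scheme

/-! ### A finite model of convergence -/

namespace Ty

/-- The pair of the number of codes for semantic values of type `τ` and of the number of tuples of
codes for the arguments of a term of type `τ`. -/
def size : Ty → ℕ × ℕ
  | o => (2, 1)
  | arr a b => (2 ^ (1 + (size a).1 * (size b).2), (size a).1 * (size b).2)

/-- The number of codes for semantic values of type `τ`. A code of type `o` is a bit, which says
whether a term converges. In a code of type `σ → τ`, the bit at `0` says whether a term converges,
and the bit at `w + 1` whether it still converges once it is applied to the arguments with the codes
that `w` lists, see `decode`. -/
def card (τ : Ty) : ℕ := τ.size.1

/-- The number of tuples `(d₁, …, dₖ)` of codes for the arguments of `τ = τ₁ → ⋯ → τₖ → o`. -/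
def idx (τ : Ty) : ℕ := τ.size.2

@[simp] theorem card_o : card o = 2 := rfl
@[simp] theorem idx_o : idx o = 1 := rfl
theorem card_arr (a b : Ty) : card (arr a b) = 2 ^ (1 + card a * idx b) := rfl
theorem idx_arr (a b : Ty) : idx (arr a b) = card a * idx b := rfl

theorem card_pos (τ : Ty) : 0 < card τ := by
  cases τ with
  | o => simp
  | arr a b => rw [card_arr]; positivity

theorem idx_pos (τ : Ty) : 0 < idx τ := by
  induction τ with
  | o => simp
  | arr a b _ ih => rw [idx_arr]; exact Nat.mul_pos (card_pos a) ih

theorem add_mul_lt {a b x w : ℕ} (hx : x < a) (hw : w < b) : x + a * w < a * b :=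
  calc x + a * w < a + a * w := by omega
    _ = a * (w + 1) := by ring
    _ ≤ a * b := Nat.mul_le_mul_left _ hw

end Ty

/-- The number with the `n` binary digits `r 0, …, r (n - 1)`, least significant first. -/
def ofBits (r : ℕ → Bool) : ℕ → ℕ
  | 0 => 0
  | n + 1 => 2 ^ n * (r n).toNat + ofBits r n

theorem ofBits_lt (r : ℕ → Bool) (n : ℕ) : ofBits r n < 2 ^ n := by
  induction n with
  | zero => simp [ofBits]
  | succ n ih =>
    rw [ofBits, pow_succ]
    have := Nat.mul_le_mul_left (2 ^ n) (Bool.toNat_le (r n))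
    omega

theorem testBit_ofBits (r : ℕ → Bool) {n i : ℕ} (h : i < n) : (ofBits r n).testBit i = r i := by
  induction n with
  | zero => omega
  | succ n ih =>
    rw [ofBits, Nat.testBit_two_pow_mul_add _ (ofBits_lt r n)]
    split_ifs with hi
    · exact ih hi
    · obtain rfl : i = n := by omega
      cases r i <;> simp

theorem ofBits_congr {r r' : ℕ → Bool} {n : ℕ} (h : ∀ i < n, r i = r' i) :
    ofBits r n = ofBits r' n := by
  induction n with
  | zero => rfl
  | succ n ih => rw [ofBits, ofBits, ih fun i hi => h i (by omega), h n (by omega)]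

/-- A code says that the terms it describes converge. -/
def conv (d : ℕ) : Bool := d.testBit 0

/-- The code of type `τ` with convergence bit `c` and with the results `r`. It is strict: without
convergence there are no results. -/
def mk (τ : Ty) (c : Bool) (r : ℕ → Bool) : ℕ :=
  match τ with
  | .o => (c && r 0).toNat
  | .arr _ _ => ofBits (fun i => c && (i == 0 || r (i - 1))) (1 + τ.idx)

/-- The code of type `b` of an application, from a code `f` of type `a → b` and a code `x` of
type `a`. -/
def appCode (a b : Ty) (f x : ℕ) : ℕ :=
  mk b (conv f && conv x) fun w => f.testBit (1 + (x + a.card * w))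

/-- The list of the codes that the mixed radix number `w` stands for. -/
def decode : List Ty → ℕ → List ℕ
  | [], _ => []
  | a :: as, w => w % a.card :: decode as (w / a.card)

/-- The mixed radix number that stands for a list of codes. -/
def encode : List Ty → List ℕ → ℕ
  | a :: as, x :: xs => x + a.card * encode as xs
  | _, _ => 0

/-- The code of type `τ` with convergence bit `c` and with the results given by a function of the
tuple of arguments. -/
def cst (τ : Ty) (c : Bool) (h : List ℕ → Bool) : ℕ := mk τ c fun w => h (decode τ.args w)

theorem decode_add {a : Ty} {as : List Ty} {x w : ℕ} (hx : x < a.card) :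
    decode (a :: as) (x + a.card * w) = x :: decode as w := by
  rw [decode, Nat.add_mul_mod_self_left, Nat.mod_eq_of_lt hx, Nat.add_mul_div_left _ _ a.card_pos,
    Nat.div_eq_of_lt hx, zero_add]

theorem forall₂_decode (as : List Ty) (w : ℕ) :
    List.Forall₂ (fun (a : Ty) d => d < a.card) as (decode as w) := by
  induction as generalizing w with
  | nil => exact .nil
  | cons a as ih => exact .cons (Nat.mod_lt _ a.card_pos) (ih _)

theorem decode_encode {as : List Ty} {xs : List ℕ}
    (h : List.Forall₂ (fun (a : Ty) d => d < a.card) as xs) : decode as (encode as xs) = xs := by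
  induction h with
  | nil => rfl
  | cons h1 _ ih => rw [encode, decode_add h1, ih]

theorem encode_lt {τ : Ty} {xs : List ℕ}
    (h : List.Forall₂ (fun (a : Ty) d => d < a.card) τ.args xs) : encode τ.args xs < τ.idx := by
  induction τ generalizing xs with
  | o => simp [Ty.args, encode]
  | arr a b _ ih =>
    rw [Ty.args] at h ⊢
    cases h with
    | cons h1 h2 => exact Ty.add_mul_lt h1 (ih h2)

theorem mk_lt (τ : Ty) (c : Bool) (r : ℕ → Bool) : mk τ c r < τ.card := by
  cases τ with
  | o => exact Nat.lt_succ_of_le (Bool.toNat_le _)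
  | arr a b => exact ofBits_lt _ _

theorem conv_mk_o (c : Bool) (r : ℕ → Bool) : conv (mk .o c r) = (c && r 0) := by
  simp only [conv, mk]
  cases c && r 0 <;> simp

theorem conv_mk_arr (a b : Ty) (c : Bool) (r : ℕ → Bool) : conv (mk (.arr a b) c r) = c := by
  simp only [conv, mk]
  rw [testBit_ofBits _ (by omega)]
  simp

theorem conv_of_conv_mk {τ : Ty} {c : Bool} {r : ℕ → Bool} (h : conv (mk τ c r)) : c := by
  cases τ with
  | o => rw [conv_mk_o, Bool.and_eq_true] at h; exact h.1
  | arr a b => rwa [conv_mk_arr] at h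

theorem conv_of_conv_appCode {a b : Ty} {f x : ℕ} (h : conv (appCode a b f x)) :
    conv f ∧ conv x := by
  have := conv_of_conv_mk h
  rwa [Bool.and_eq_true] at this

theorem testBit_mk_arr {a b : Ty} {c : Bool} {r : ℕ → Bool} {w : ℕ} (hw : w < (Ty.arr a b).idx) :
    (mk (.arr a b) c r).testBit (1 + w) = (c && r w) := by
  simp only [mk]
  rw [testBit_ofBits _ (by omega)]
  have h1 : 1 + w - 1 = w := by omega
  have h2 : (1 + w == 0) = false := by simp
  rw [h1, h2, Bool.false_or]

theorem mk_congr {τ : Ty} {c : Bool} {r r' : ℕ → Bool} (h : ∀ w < τ.idx, c → r w = r' w) :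
    mk τ c r = mk τ c r' := by
  cases c with
  | false => cases τ <;> simp [mk]
  | true =>
    cases τ with
    | o => simp [mk, h 0 Ty.idx_o.ge rfl]
    | arr a b =>
      refine ofBits_congr fun i hi => ?_
      rcases Nat.eq_zero_or_pos i with rfl | h0
      · simp
      · rw [h (i - 1) (by omega) rfl]

theorem mk_false (τ : Ty) (r : ℕ → Bool) : mk τ false r = 0 := by
  have h : ∀ n, ofBits (fun _ => false) n = 0 := by
    intro n
    induction n with
    | zero => rfl
    | succ n ih => simp [ofBits, ih]
  cases τ <;> simp [mk, h]

theorem appCode_mk {a b : Ty} {c : Bool} {r : ℕ → Bool} {x : ℕ} (hx : x < a.card) :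
    appCode a b (mk (.arr a b) c r) x = mk b (c && conv x) fun w => r (x + a.card * w) := by
  rw [appCode, conv_mk_arr]
  refine mk_congr fun w hw hc => ?_
  rw [testBit_mk_arr (by rw [Ty.idx_arr]; exact Ty.add_mul_lt hx hw)]
  cases c <;> simp_all

theorem appCode_cst {a b : Ty} {c : Bool} {h : List ℕ → Bool} {x : ℕ} (hx : x < a.card) :
    appCode a b (cst (.arr a b) c h) x = cst b (c && conv x) fun l => h (x :: l) := by
  rw [cst, appCode_mk hx, cst]
  simp only [Ty.args, decode_add hx]

theorem conv_cst_o (c : Bool) (h : List ℕ → Bool) : conv (cst .o c h) = (c && h []) :=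
  conv_mk_o _ _

theorem conv_cst_arr (a b : Ty) (c : Bool) (h : List ℕ → Bool) :
    conv (cst (.arr a b) c h) = c := conv_mk_arr _ _ _ _

theorem cst_lt (τ : Ty) (c : Bool) (h : List ℕ → Bool) : cst τ c h < τ.card := mk_lt _ _ _

theorem appCode_lt (a b : Ty) (f x : ℕ) : appCode a b f x < b.card := mk_lt _ _ _

/-- The code of an iterated application. -/
def appsCode : Ty → ℕ → List ℕ → ℕ
  | .arr a b, f, x :: xs => appsCode b (appCode a b f x) xs
  | _, f, _ => f

theorem conv_appsCode_cst {τ : Ty} {c : Bool} {h : List ℕ → Bool} {xs : List ℕ}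
    (hx : List.Forall₂ (fun (a : Ty) d => d < a.card) τ.args xs) :
    conv (appsCode τ (cst τ c h) xs) = (c && xs.all conv && h xs) := by
  induction τ generalizing c h xs with
  | o => rw [Ty.args] at hx; cases hx; simp [appsCode, conv_cst_o]
  | arr a b _ ih =>
    rw [Ty.args] at hx
    cases hx with
    | cons h1 h2 => rw [appsCode, appCode_cst h1, ih h2]; simp [Bool.and_assoc]

/-! ### The information order -/

mutual

/-- A code stands for a hereditarily monotone function. -/
def Good : Ty → ℕ → Prop
  | .o, f => f < 2
  | .arr a b, f => f < (Ty.arr a b).card ∧ (∀ x, Good a x → Good b (appCode a b f x)) ∧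
      ∀ x y, Good a x → Good a y → Le a x y → Le b (appCode a b f x) (appCode a b f y)

/-- The pointwise order: the terms described by the second code converge whenever those described by
the first one do. Only hereditarily monotone arguments count. -/
def Le : Ty → ℕ → ℕ → Prop
  | .o, f, g => conv f → conv g
  | .arr a b, f, g => (conv f → conv g) ∧ ∀ x, Good a x → Le b (appCode a b f x) (appCode a b g x)

end

theorem Good.lt {τ : Ty} {f : ℕ} (h : Good τ f) : f < τ.card := by
  cases τ with
  | o => simp only [Good] at h; exact h
  | arr a b => simp only [Good] at h; exact h.1

theorem Le.refl (τ : Ty) (f : ℕ) : Le τ f f := by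
  induction τ generalizing f with
  | o => simp only [Le]; exact id
  | arr a b _ ih => simp only [Le]; exact ⟨id, fun x _ => ih _⟩

theorem Le.trans {τ : Ty} {f g h : ℕ} (h1 : Le τ f g) (h2 : Le τ g h) : Le τ f h := by
  induction τ generalizing f g h with
  | o => simp only [Le] at *; exact h2 ∘ h1
  | arr a b _ ih =>
    simp only [Le] at *
    exact ⟨h2.1 ∘ h1.1, fun x hx => ih (h1.2 x hx) (h2.2 x hx)⟩

theorem Le.imp {τ : Ty} {f g : ℕ} (h : Le τ f g) : conv f → conv g := by
  cases τ with
  | o => simpa only [Le] using h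
  | arr a b => simp only [Le] at h; exact h.1

/-- Two codes of ground type that converge simultaneously are equal. -/
theorem eq_of_conv_eq {f g : ℕ} (hf : f < 2) (hg : g < 2) (h : conv f = conv g) : f = g := by
  interval_cases f <;> interval_cases g <;> simp [HORS.conv] at h ⊢

/-- A code that has no convergence bit lies below every code. -/
theorem Le.of_not_conv {τ : Ty} {f : ℕ} (h : conv f = false) (g : ℕ) : Le τ f g := by
  induction τ generalizing f g with
  | o => simp [Le, h]
  | arr a b _ ih =>
    simp only [Le, h]
    refine ⟨by simp, fun x _ => ih ?_ _⟩
    by_contra h'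
    rw [Bool.not_eq_false] at h'
    rw [(conv_of_conv_appCode h').1] at h
    cases h

theorem Le.cst {τ : Ty} {c c' : Bool} {h h' : List ℕ → Bool} (hc : c → c')
    (hh : ∀ ds, List.Forall₂ Good τ.args ds → h ds → h' ds) :
    Le τ (cst τ c h) (cst τ c' h') := by
  induction τ generalizing c c' h h' with
  | o =>
    simp only [Le, conv_cst_o, Bool.and_eq_true]
    exact fun ⟨h1, h2⟩ => ⟨hc h1, hh [] .nil h2⟩
  | arr a b _ ih =>
    simp only [Le, conv_cst_arr]
    refine ⟨hc, fun x hx => ?_⟩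
    rw [appCode_cst hx.lt, appCode_cst hx.lt]
    refine ih ?_ fun ds hds => hh (x :: ds) (.cons hx hds)
    simp only [Bool.and_eq_true]
    exact fun ⟨h1, h2⟩ => ⟨hc h1, h2⟩

/-- The order on tuples of codes. -/
inductive LeList : List Ty → List ℕ → List ℕ → Prop
  | nil : LeList [] [] []
  | cons {a as x y xs ys} : Le a x y → LeList as xs ys → LeList (a :: as) (x :: xs) (y :: ys)

theorem LeList.refl {as : List Ty} {xs : List ℕ} (h : List.Forall₂ Good as xs) :
    LeList as xs xs := by
  induction h with
  | nil => exact .nil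
  | cons _ _ ih => exact .cons (Le.refl _ _) ih

/-- The code of a monotone function of the tuple of arguments is hereditarily monotone. -/
theorem Good.cst {τ : Ty} (c : Bool) {h : List ℕ → Bool}
    (hh : ∀ ds ds', List.Forall₂ Good τ.args ds → List.Forall₂ Good τ.args ds' →
      LeList τ.args ds ds' → h ds → h ds') : Good τ (cst τ c h) := by
  induction τ generalizing c h with
  | o => simp only [Good]; exact cst_lt _ _ _
  | arr a b _ ih =>
    simp only [Good]
    refine ⟨cst_lt _ _ _, fun x hx => ?_, fun x y hx hy hxy => ?_⟩
    · rw [appCode_cst hx.lt]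
      exact ih _ fun ds ds' h1 h2 h3 => hh _ _ (.cons hx h1) (.cons hx h2) (.cons (Le.refl _ _) h3)
    · rw [appCode_cst hx.lt, appCode_cst hy.lt]
      refine Le.cst ?_ fun ds hds => hh _ _ (.cons hx hds) (.cons hy hds) (.cons hxy (.refl hds))
      simp only [Bool.and_eq_true]
      exact fun ⟨h1, h2⟩ => ⟨h1, hxy.imp h2⟩

theorem Good.zero (τ : Ty) : Good τ 0 := by
  induction τ with
  | o => simp [Good]
  | arr a b _ ih =>
    have h0 : ∀ x, appCode a b 0 x = 0 := fun x => by simp [appCode, conv, mk_false]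
    simp only [Good, h0]
    exact ⟨Ty.card_pos _, fun _ _ => ih, fun _ _ _ _ _ => Le.refl _ _⟩

theorem Good.app {a b : Ty} {f x : ℕ} (hf : Good (.arr a b) f) (hx : Good a x) :
    Good b (appCode a b f x) := by
  simp only [Good] at hf; exact hf.2.1 x hx

theorem Le.app {a b : Ty} {f g x y : ℕ} (hg : Good (.arr a b) g) (hx : Good a x) (hy : Good a y)
    (hfg : Le (.arr a b) f g) (hxy : Le a x y) : Le b (appCode a b f x) (appCode a b g y) := by
  simp only [Good] at hg
  simp only [Le] at hfg
  exact (hfg.2 x hx).trans (hg.2.2 x y hx hy hxy)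

theorem Le.apps {τ : Ty} {f g : ℕ} {xs : List ℕ} (h : Le τ f g)
    (hx : List.Forall₂ Good τ.args xs) : Le .o (appsCode τ f xs) (appsCode τ g xs) := by
  induction τ generalizing f g xs with
  | o => rw [Ty.args] at hx; cases hx; exact h
  | arr a b _ ih =>
    rw [Ty.args] at hx
    cases hx with
    | cons h1 h2 =>
      simp only [Le] at h
      exact ih (h.2 _ h1) h2

/-! ### Typing -/

namespace Ty

/-- The type `σ` of the first argument of a term of type `σ → τ`. -/
def dom : Ty → Ty
  | o => o
  | arr a _ => a

/-- The type `τ` of the application of a term of type `σ → τ`. -/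
def cod : Ty → Ty
  | o => o
  | arr _ b => b

/-- The type `σ₁ → ⋯ → σₘ → τ`. -/
def arrs (as : List Ty) (τ : Ty) : Ty := as.foldr arr τ

theorem args_arrs (as : List Ty) (τ : Ty) : (arrs as τ).args = as ++ τ.args := by
  induction as with
  | nil => rfl
  | cons a as ih => simpa [arrs, args] using ih

theorem arrs_args (τ : Ty) : arrs τ.args .o = τ := by
  induction τ with
  | o => rfl
  | arr a b _ ih => simpa [arrs, args] using ih

theorem arity_arrs (as : List Ty) (τ : Ty) : (arrs as τ).arity = as.length + τ.arity := by
  simp [arity, args_arrs]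

theorem eq_o_of_arity {τ : Ty} (h : τ.arity = 0) : τ = o := by
  cases τ with
  | o => rfl
  | arr a b => simp [arity, args] at h

end Ty

namespace Term

/-- The type of a term, computed from the types of the non-terminals and of the variables. For an
ill-typed term the value is of no interest. -/
def inferTy (N X : List Ty) : Term → Ty
  | terminal a => a.type
  | nonterminal F => N.getD F .o
  | var i => X.getD i .o
  | app t _ => (inferTy N X t).cod

variable {Sig : List Terminal} {N X : List Ty}

theorem HasType.inferTy_eq {t : Term} {τ : Ty} (h : HasType Sig N X t τ) : t.inferTy N X = τ := by
  induction h with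
  | terminal => rfl
  | nonterminal h => simp [inferTy, h]
  | var h => simp [inferTy, h]
  | app _ _ ih _ => simp [inferTy, ih, Ty.cod]

theorem hasType_apps {t : Term} {ts : List Term} {as : List Ty} {τ : Ty}
    (h : HasType Sig N X t (Ty.arrs as τ)) (hs : List.Forall₂ (HasType Sig N X) ts as) :
    HasType Sig N X (t.apps ts) τ := by
  induction hs generalizing t with
  | nil => exact h
  | cons h1 _ ih => exact ih (.app h h1)

theorem HasType.apps_inv {t : Term} {ts : List Term} {τ : Ty}
    (h : HasType Sig N X (t.apps ts) τ) :
    ∃ as, List.Forall₂ (HasType Sig N X) ts as ∧ HasType Sig N X t (Ty.arrs as τ) := by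
  induction ts generalizing t with
  | nil => exact ⟨[], .nil, h⟩
  | cons s ts ih =>
    obtain ⟨as, h1, h2⟩ := ih (t := Term.app t s) h
    cases h2 with
    | app h3 h4 => exact ⟨_ :: as, .cons h4 h1, h3⟩

theorem HasType.subst {e : Term} {ts : List Term} {τ : Ty} {Y : List Ty}
    (h : HasType Sig N X e τ) (hs : List.Forall₂ (HasType Sig N Y) ts X) :
    HasType Sig N Y (e.subst ts) τ := by
  induction h with
  | terminal h => exact .terminal h
  | nonterminal h => exact .nonterminal h
  | @var i τ h =>
    have hi : i < X.length := (List.getElem?_eq_some_iff.1 h).1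
    have hi' : i < ts.length := hs.length_eq ▸ hi
    have := List.Forall₂.get hs hi' hi
    rw [List.get_eq_getElem, List.get_eq_getElem, (List.getElem?_eq_some_iff.1 h).2] at this
    simpa [Term.subst, List.getD_eq_getElem?_getD, hi'] using this
  | app _ _ ih1 ih2 => exact .app ih1 ih2

theorem subst_nil (t : Term) : t.subst [] = t := by
  induction t with
  | app t s iht ihs => simp [subst, iht, ihs]
  | _ => rfl

/-- A closed term is a terminal or a non-terminal applied to arguments. -/
theorem HasType.head_eq {t : Term} {τ : Ty} (h : HasType Sig N [] t τ) :
    (∃ a, t.head = .terminal a) ∨ ∃ F, t.head = .nonterminal F := by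
  generalize hX : ([] : List Ty) = X at h
  induction h with
  | terminal => exact Or.inl ⟨_, rfl⟩
  | nonterminal => exact Or.inr ⟨_, rfl⟩
  | var h => subst hX; simp at h
  | app _ _ ih _ => exact ih

theorem eq_apps_of_head {t : Term} {F : ℕ} (h : t.head = nonterminal F) :
    ∃ ts, t = (nonterminal F).apps ts := by
  induction t with
  | app t s iht _ =>
    obtain ⟨ts, rfl⟩ := iht h
    exact ⟨ts ++ [s], (apps_concat _ _ _).symm⟩
  | terminal a => simp [head] at h
  | nonterminal F' => exact ⟨[], h⟩
  | var i => simp [head] at h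

theorem HasType.of_head_terminal {t : Term} {τ : Ty} {a : Terminal} (h : HasType Sig N X t τ)
    (ht : t.head = .terminal a) : ∃ k, τ = Ty.ofArity k := by
  induction h with
  | terminal => exact ⟨_, rfl⟩
  | nonterminal h => simp [head] at ht
  | var h => simp [head] at ht
  | @app t s σ τ _ _ ih _ =>
    obtain ⟨k, hk⟩ := ih ht
    cases k with
    | zero => simp [Ty.ofArity] at hk
    | succ k =>
      rw [Ty.ofArity, Ty.arr.injEq] at hk
      exact ⟨k, hk.2⟩

theorem HasType.dom_eq_o_of_head {t : Term} {σ τ : Ty} {a : Terminal}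
    (h : HasType Sig N X t (.arr σ τ)) (ht : t.head = .terminal a) : σ = .o := by
  obtain ⟨k, hk⟩ := h.of_head_terminal ht
  cases k with
  | zero => simp [Ty.ofArity] at hk
  | succ k => rw [Ty.ofArity, Ty.arr.injEq] at hk; exact hk.1

end Term

namespace Scheme

variable {G : Scheme}

theorem types_getElem? (G : Scheme) (F : ℕ) : G.types[F]? = G.rules[F]?.map Prod.fst := by
  simp [types]

theorem Contracts.hasType {F : ℕ} {ts : List Term} {e : Term} {X : List Ty} {σ : Ty}
    (hG : G.IsHORS) (hc : G.Contracts F ts e)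
    (h : Term.HasType G.terminals G.types X ((Term.nonterminal F).apps ts) σ) :
    ∃ τ, G.rules[F]? = some (τ, e) ∧ σ = .o ∧
      List.Forall₂ (Term.HasType G.terminals G.types X) ts τ.args ∧
      e.HasType G.terminals G.types τ.args .o := by
  obtain ⟨τ, he, hl⟩ := hc
  obtain ⟨as, h1, h2⟩ := h.apps_inv
  cases h2 with
  | nonterminal h2 =>
    rw [types_getElem?, he] at h2
    simp only [Option.map_some, Option.some.injEq] at h2
    subst h2
    rw [Ty.arity_arrs, h1.length_eq] at hl
    obtain rfl := Ty.eq_o_of_arity (show σ.arity = 0 by omega)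
    refine ⟨_, he, rfl, ?_, hG.body _ (List.mem_of_getElem? he)⟩
    rw [Ty.args_arrs]
    simpa [Ty.args] using h1

/-- Subject reduction. -/
theorem Step.hasType {X : List Ty} (hG : G.IsHORS) {t t' : Term} {τ : Ty} (h : G.Step t t')
    (ht : t.HasType G.terminals G.types X τ) : t'.HasType G.terminals G.types X τ := by
  induction h generalizing τ with
  | redex hc =>
    obtain ⟨τ, -, rfl, hs, he⟩ := hc.hasType hG ht
    exact he.subst hs
  | left _ ih => cases ht with | app h1 h2 => exact .app (ih h1) h2
  | right _ ih => cases ht with | app h1 h2 => exact .app h1 (ih h2)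

theorem hasType_of_innermost {X : List Ty} (hG : G.IsHORS) {t t' : Term} {τ : Ty}
    (h : ReflTransGen G.InnermostStep t t') (ht : t.HasType G.terminals G.types X τ) :
    t'.HasType G.terminals G.types X τ := by
  induction h with
  | refl => exact ht
  | tail _ h ih => exact h.step.hasType hG ih

/-! ### Normal forms -/

/-- A term is normal if no subterm is a redex. -/
def Normal (G : Scheme) (t : Term) : Prop := ∀ r : Term, r.Subterm t → ¬ G.IsRedex r

theorem Normal.left {t s : Term} (h : G.Normal (.app t s)) : G.Normal t :=
  fun r hr => h r (.left hr)

theorem Normal.right {t s : Term} (h : G.Normal (.app t s)) : G.Normal s :=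
  fun r hr => h r (.right hr)

theorem Normal.not_isRedex {t : Term} (h : G.Normal t) : ¬ G.IsRedex t := h t .refl

theorem normal_app {t s : Term} (ht : G.Normal t) (hs : G.Normal s)
    (h : ¬ G.IsRedex (.app t s)) : G.Normal (.app t s) := by
  intro r hr
  cases hr with
  | refl => exact h
  | left hr => exact ht r hr
  | right hr => exact hs r hr

theorem normal_nonterminal {F : ℕ} (h : ¬ G.IsRedex (.nonterminal F)) :
    G.Normal (.nonterminal F) := by
  intro r hr
  cases hr
  exact h

theorem IsRedex.head {t : Term} (h : G.IsRedex t) : ∃ F, t.head = .nonterminal F := by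
  obtain ⟨F, ts, e, -, rfl⟩ := h
  exact ⟨F, Term.head_apps _ _⟩

theorem not_isRedex_of_head {t : Term} {a : Terminal} (h : t.head = .terminal a) :
    ¬ G.IsRedex t := by
  intro h'
  obtain ⟨F, hF⟩ := h'.head
  rw [h] at hF
  cases hF

theorem normal_terminal (a : Terminal) : G.Normal (.terminal a) := by
  intro r hr
  cases hr
  exact not_isRedex_of_head rfl

/-- A non-terminal applied to fewer arguments than its arity is not a redex. -/
theorem normal_apps {F : ℕ} {ts : List Term} {τ : Ty} {e : Term} (he : G.rules[F]? = some (τ, e))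
    (hl : ts.length < τ.arity) (hs : ∀ s ∈ ts, G.Normal s) :
    G.Normal ((Term.nonterminal F).apps ts) := by
  have hred : ∀ us : List Term, us.length < τ.arity →
      ¬ G.IsRedex ((Term.nonterminal F).apps us) := by
    rintro us hu ⟨F', us', e', ⟨τ', he', hl'⟩, h⟩
    obtain ⟨rfl, rfl⟩ := Term.nonterminal_apps_inj h
    rw [he] at he'
    cases he'
    omega
  induction ts using List.reverseRecOn with
  | nil => exact normal_nonterminal (hred [] hl)
  | append_singleton l s ih =>
    have h2 := hred _ hl
    rw [Term.apps_concat] at h2 ⊢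
    simp only [List.length_append, List.length_singleton] at hl
    exact normal_app (ih (by omega) fun s hs' => hs s (by simp [hs'])) (hs s (by simp)) h2

/-- In a well-typed term, redexes have ground type. -/
theorem IsRedex.eq_o {X : List Ty} (hG : G.IsHORS) {t : Term} {τ : Ty} (h : G.IsRedex t)
    (ht : t.HasType G.terminals G.types X τ) : τ = .o := by
  obtain ⟨F, ts, e, hc, rfl⟩ := h
  exact (hc.hasType hG ht).choose_spec.2.1

/-- A ground term with a non-terminal as its head is a redex. -/
theorem exists_redex {X : List Ty} {t : Term} {F : ℕ} (hF : t.head = .nonterminal F)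
    (ht : t.HasType G.terminals G.types X .o) :
    ∃ ts e, G.Contracts F ts e ∧ t = (Term.nonterminal F).apps ts := by
  obtain ⟨ts, rfl⟩ := Term.eq_apps_of_head hF
  obtain ⟨as, h1, h2⟩ := ht.apps_inv
  cases h2 with
  | nonterminal h2 =>
    rw [types_getElem?, Option.map_eq_some_iff] at h2
    obtain ⟨⟨τ, e⟩, he, h2⟩ := h2
    refine ⟨ts, e, ⟨τ, he, ?_⟩, rfl⟩
    rw [show τ = _ from h2, Ty.arity_arrs, h1.length_eq]
    rfl

theorem Par.eq_of_normal {t q : Term} (h : G.Par t q) (ht : G.Normal t) : q = t := by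
  obtain ⟨n, hn⟩ : ∃ n, n = sizeOf t := ⟨_, rfl⟩
  induction n using Nat.strong_induction_on generalizing t q with
  | _ n ih =>
    cases h with
    | refl => rfl
    | app h1 h2 =>
      simp only [Term.app.sizeOf_spec] at hn
      rw [ih _ (by omega) h1 ht.left rfl, ih _ (by omega) h2 ht.right rfl]
    | redex hc => exact absurd ⟨_, _, _, hc, rfl⟩ ht.not_isRedex

end Scheme

/-! ### The interpretation of terms in the model -/

theorem forall₂_getD {R : Ty → ℕ → Prop} {as : List Ty} {xs : List ℕ}
    (h : List.Forall₂ R as xs) {i : ℕ} {a : Ty} (hi : as[i]? = some a) (d : ℕ) :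
    R a (xs.getD i d) := by
  induction h generalizing i with
  | nil => simp at hi
  | cons h1 _ ih =>
    cases i with
    | zero => simp at hi; subst hi; simpa using h1
    | succ i => simp at hi; simpa using ih hi

theorem LeList.getD {as : List Ty} {xs ys : List ℕ} (h : LeList as xs ys) {i : ℕ}
    {a : Ty} (hi : as[i]? = some a) : Le a (xs.getD i 0) (ys.getD i 0) := by
  induction h generalizing i with
  | nil => simp at hi
  | cons h1 _ ih =>
    cases i with
    | zero => simp at hi; subst hi; simpa using h1
    | succ i => simp at hi; simpa using ih hi

theorem LeList.trans {as : List Ty} {xs ys zs : List ℕ} (h : LeList as xs ys)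
    (h' : LeList as ys zs) : LeList as xs zs := by
  induction h generalizing zs with
  | nil => exact h'
  | cons h1 _ ih => cases h' with | cons h2 h' => exact .cons (h1.trans h2) (ih h')

namespace Term

/-- The code of a term, given types `N` and codes `M` of the non-terminals and types `X` and codes
`env` of the variables. -/
def code (N : List Ty) (M : List ℕ) (X : List Ty) (env : List ℕ) : Term → ℕ
  | terminal a => cst a.type true fun _ => true
  | nonterminal F => M.getD F 0
  | var i => env.getD i 0
  | app t s => appCode (t.inferTy N X).dom (t.inferTy N X).cod (code N M X env t) (code N M X env s)

variable {Sig : List Terminal} {N X : List Ty} {M env : List ℕ}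

theorem HasType.code_app {t s : Term} {σ τ : Ty} (h : HasType Sig N X t (.arr σ τ)) :
    (Term.app t s).code N M X env = appCode σ τ (t.code N M X env) (s.code N M X env) := by
  rw [code, h.inferTy_eq]
  rfl

theorem HasType.code_lt {t : Term} {τ : Ty} (h : HasType Sig N X t τ)
    (hM : List.Forall₂ (fun (a : Ty) d => d < a.card) N M)
    (hX : List.Forall₂ (fun (a : Ty) d => d < a.card) X env) : t.code N M X env < τ.card := by
  cases h with
  | terminal => exact cst_lt _ _ _
  | nonterminal h => exact forall₂_getD hM h 0
  | var h => exact forall₂_getD hX h 0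
  | app h _ => rw [h.code_app]; exact appCode_lt _ _ _ _

theorem HasType.good_code {t : Term} {τ : Ty} (h : HasType Sig N X t τ)
    (hM : List.Forall₂ Good N M) (hX : List.Forall₂ Good X env) :
    Good τ (t.code N M X env) := by
  induction h with
  | terminal => exact Good.cst _ fun _ _ _ _ _ _ => rfl
  | nonterminal h => exact forall₂_getD hM h 0
  | var h => exact forall₂_getD hX h 0
  | app h _ ih1 ih2 => rw [h.code_app]; exact ih1.app ih2

theorem HasType.le_code {t : Term} {τ : Ty} {M' env' : List ℕ} (h : HasType Sig N X t τ)
    (hM : List.Forall₂ Good N M) (hX : List.Forall₂ Good X env)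
    (hM' : List.Forall₂ Good N M') (hX' : List.Forall₂ Good X env')
    (hMM : LeList N M M') (hXX : LeList X env env') :
    Le τ (t.code N M X env) (t.code N M' X env') := by
  induction h with
  | terminal => exact Le.refl _ _
  | nonterminal h => exact hMM.getD h
  | var h => exact hXX.getD h
  | app h h' ih1 ih2 =>
    rw [h.code_app, h.code_app]
    exact Le.app (h.good_code hM' hX') (h'.good_code hM hX) (h'.good_code hM' hX') ih1 ih2

/-- The code of an instance of a term is the code of the term in the environment given by the codes
of the substituted terms. -/
theorem HasType.code_subst {e : Term} {ts : List Term} {τ : Ty} {Y : List Ty} {env' : List ℕ}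
    (h : HasType Sig N X e τ) (hs : List.Forall₂ (HasType Sig N Y) ts X) :
    (e.subst ts).code N M Y env' = e.code N M X (ts.map (code N M Y env')) := by
  induction h with
  | terminal => rfl
  | nonterminal => rfl
  | @var i τ h =>
    have hi : i < ts.length := hs.length_eq ▸ (List.getElem?_eq_some_iff.1 h).1
    simp [Term.subst, code, List.getD_eq_getElem?_getD, hi]
  | app h _ ih1 ih2 =>
    rw [h.code_app, Term.subst, (h.subst hs).code_app, ih1, ih2]

end Term

namespace Scheme

/-- One round of the fixpoint iteration that computes the codes of the non-terminals. -/
def nextCodes (G : Scheme) (M : List ℕ) : List ℕ :=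
  G.rules.map fun p => cst p.1 true fun ds => conv (p.2.code G.types M p.1.args ds)

/-- The codes of the non-terminals after `n` rounds. -/
def codesAt (G : Scheme) : ℕ → List ℕ
  | 0 => G.rules.map fun _ => 0
  | n + 1 => G.nextCodes (codesAt G n)

/-- A number of rounds after which the codes of the non-terminals are stable. -/
def rounds (G : Scheme) : ℕ := ((G.types.map Ty.card).sum) ^ G.types.length

/-- The codes of the non-terminals. -/
def codes (G : Scheme) : List ℕ := G.codesAt (G.rounds + 1)

variable {G : Scheme}

theorem length_codesAt (n : ℕ) : (G.codesAt n).length = G.types.length := by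
  cases n <;> simp [codesAt, nextCodes, types]

theorem forall₂_map {α β γ : Type*} {R : β → γ → Prop} {l : List α} {f : α → β} {g : α → γ}
    (h : ∀ a ∈ l, R (f a) (g a)) : List.Forall₂ R (l.map f) (l.map g) := by
  induction l with
  | nil => exact .nil
  | cons a l ih => exact .cons (h a (by simp)) (ih fun b hb => h b (by simp [hb]))

theorem leList_map {α : Type*} {l : List α} {f : α → Ty} {g g' : α → ℕ}
    (h : ∀ a ∈ l, Le (f a) (g a) (g' a)) : LeList (l.map f) (l.map g) (l.map g') := by
  induction l with
  | nil => exact .nil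
  | cons a l ih => exact .cons (h a (by simp)) (ih fun b hb => h b (by simp [hb]))

theorem forall₂_good_nextCodes (hG : G.IsHORS) {M : List ℕ} (hM : List.Forall₂ Good G.types M) :
    List.Forall₂ Good G.types (G.nextCodes M) := by
  refine forall₂_map fun p hp => Good.cst _ fun ds ds' h h' hle => ?_
  exact ((hG.body p hp).le_code hM h hM h' (.refl hM) hle).imp

theorem nextCodes_mono (hG : G.IsHORS) {M M' : List ℕ} (hM : List.Forall₂ Good G.types M)
    (hM' : List.Forall₂ Good G.types M') (h : LeList G.types M M') :
    LeList G.types (G.nextCodes M) (G.nextCodes M') := by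
  refine leList_map fun p hp => Le.cst id fun ds hds => ?_
  exact ((hG.body p hp).le_code hM hds hM' hds h (.refl hds)).imp

theorem forall₂_good_codesAt (hG : G.IsHORS) (n : ℕ) :
    List.Forall₂ Good G.types (G.codesAt n) := by
  induction n with
  | zero => exact forall₂_map fun p _ => Good.zero _
  | succ n ih => exact forall₂_good_nextCodes hG ih

theorem codesAt_le_succ (hG : G.IsHORS) (n : ℕ) :
    LeList G.types (G.codesAt n) (G.codesAt (n + 1)) := by
  induction n with
  | zero => exact leList_map fun p _ => Le.of_not_conv (by simp [conv]) _
  | succ n ih =>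
    exact nextCodes_mono hG (forall₂_good_codesAt hG _) (forall₂_good_codesAt hG _) ih

theorem codesAt_mono (hG : G.IsHORS) {m n : ℕ} (h : m ≤ n) :
    LeList G.types (G.codesAt m) (G.codesAt n) := by
  induction h with
  | refl => exact .refl (forall₂_good_codesAt hG _)
  | step _ ih => exact ih.trans (codesAt_le_succ hG _)

/-- The iteration is stable after `rounds` rounds: among more rounds than there are lists of codes,
two have the same result, and between them nothing can have changed. -/
theorem codesAt_succ_le (hG : G.IsHORS) {n : ℕ} (hn : G.rounds ≤ n) :
    LeList G.types (G.codesAt (n + 1)) (G.codesAt n) := by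
  have hlt : ∀ (k : ℕ) (F : Fin G.types.length),
      (G.codesAt k).getD F 0 < (G.types.map Ty.card).sum := by
    intro k F
    have h1 := forall₂_getD (forall₂_good_codesAt hG k)
      (List.getElem?_eq_some_iff.2 ⟨F.2, rfl⟩) 0
    exact h1.lt.trans_le (List.le_sum_of_mem (List.mem_map_of_mem (List.getElem_mem F.2)))
  let f : Fin (G.rounds + 1) → Fin G.types.length → Fin (G.types.map Ty.card).sum :=
    fun k F => ⟨(G.codesAt k).getD F 0, hlt k F⟩
  obtain ⟨i, j, hij, hf⟩ : ∃ i j : Fin (G.rounds + 1), i < j ∧ f i = f j := by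
    obtain ⟨i, j, hne, hf⟩ := Fintype.exists_ne_map_eq_of_card_lt f (by
      rw [Fintype.card_fin, Fintype.card_fun, Fintype.card_fin, Fintype.card_fin]
      exact Nat.lt_succ_self _)
    rcases lt_or_gt_of_ne hne with h | h
    · exact ⟨i, j, h, hf⟩
    · exact ⟨j, i, h, hf.symm⟩
  have heq : G.codesAt i = G.codesAt j := by
    refine List.ext_getElem (by simp [length_codesAt]) fun F h1 h2 => ?_
    have := congrArg Fin.val (congrFun hf ⟨F, by rwa [length_codesAt] at h1⟩)
    simpa [f, List.getD_eq_getElem?_getD, h1, h2] using this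
  have hstart : LeList G.types (G.codesAt (i + 1)) (G.codesAt i) := by
    rw [heq]
    exact codesAt_mono hG hij
  have hin : (i : ℕ) ≤ n := by omega
  clear hn
  induction hin with
  | refl => exact hstart
  | step _ ih =>
    exact nextCodes_mono hG (forall₂_good_codesAt hG _) (forall₂_good_codesAt hG _) ih

theorem forall₂_good_codes (hG : G.IsHORS) : List.Forall₂ Good G.types G.codes :=
  forall₂_good_codesAt hG _

theorem forall₂_lt_codes (hG : G.IsHORS) :
    List.Forall₂ (fun (a : Ty) d => d < a.card) G.types G.codes :=
  (forall₂_good_codes hG).imp fun _ _ h => h.lt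

theorem getD_nextCodes {F : ℕ} {τ : Ty} {e : Term} (he : G.rules[F]? = some (τ, e))
    (M : List ℕ) : (G.nextCodes M).getD F 0 =
      cst τ true fun ds => conv (e.code G.types M τ.args ds) := by
  simp [nextCodes, he]

theorem types_of_rules {F : ℕ} {τ : Ty} {e : Term} (he : G.rules[F]? = some (τ, e)) :
    G.types[F]? = some τ := by
  simp [types_getElem?, he]

/-- The codes of the non-terminals are a fixpoint, as far as monotone arguments are concerned. -/
theorem conv_appsCode_codes (hG : G.IsHORS) {F : ℕ} {τ : Ty} {e : Term}
    (he : G.rules[F]? = some (τ, e)) {ds : List ℕ} (hds : List.Forall₂ Good τ.args ds) :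
    conv (appsCode τ (G.codes.getD F 0) ds) =
      (ds.all conv && conv (e.code G.types G.codes τ.args ds)) := by
  have h1 := ((codesAt_succ_le hG (n := G.rounds + 1) (by omega)).getD (types_of_rules he)).apps hds
  have h2 := ((codesAt_le_succ hG (G.rounds + 1)).getD (types_of_rules he)).apps hds
  have h3 : conv (appsCode τ (G.codes.getD F 0) ds) =
      conv (appsCode τ ((G.nextCodes G.codes).getD F 0) ds) :=
    Bool.eq_iff_iff.2 ⟨h2.imp, h1.imp⟩
  rw [h3, getD_nextCodes he, conv_appsCode_cst (hds.imp fun _ _ h => h.lt), Bool.true_and]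

theorem conv_codes {F : ℕ} {a b : Ty} (h : G.types[F]? = some (.arr a b)) :
    conv (G.codes.getD F 0) := by
  rw [types_getElem?, Option.map_eq_some_iff] at h
  obtain ⟨⟨τ, e⟩, he, rfl⟩ := h
  rw [codes, codesAt, getD_nextCodes he]
  exact conv_cst_arr _ _ _ _

/-- The code of a closed term. -/
def code (G : Scheme) (t : Term) : ℕ := t.code G.types G.codes [] []

/-- The typing of closed terms. -/
abbrev Typed (G : Scheme) (t : Term) (τ : Ty) : Prop := t.HasType G.terminals G.types [] τ

theorem Typed.good (hG : G.IsHORS) {t : Term} {τ : Ty} (h : G.Typed t τ) : Good τ (G.code t) :=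
  h.good_code (forall₂_good_codes hG) .nil

theorem code_apps {t : Term} {ts : List Term} {as : List Ty} {τ : Ty}
    (h : G.Typed t (Ty.arrs as τ)) (hs : List.Forall₂ G.Typed ts as) :
    G.code (t.apps ts) = appsCode (Ty.arrs as τ) (G.code t) (ts.map G.code) := by
  induction hs generalizing t with
  | nil => cases τ <;> rfl
  | cons h1 _ ih =>
    refine (ih (.app h h1)).trans ?_
    rw [code, h.code_app]
    rfl

theorem forall₂_good_code (hG : G.IsHORS) {ts : List Term} {as : List Ty}
    (hs : List.Forall₂ G.Typed ts as) : List.Forall₂ Good as (ts.map G.code) := by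
  induction hs with
  | nil => exact .nil
  | cons h1 _ ih => exact .cons (h1.good hG) ih

/-- The code of a redex says that the redex converges if its arguments and its contractum do. -/
theorem Contracts.conv_code (hG : G.IsHORS) {F : ℕ} {ts : List Term} {e : Term} {σ : Ty}
    (hc : G.Contracts F ts e) (h : G.Typed ((Term.nonterminal F).apps ts) σ) :
    conv (G.code ((Term.nonterminal F).apps ts)) =
      ((ts.map G.code).all conv && conv (G.code (e.subst ts))) := by
  obtain ⟨τ, he, rfl, hs, hb⟩ := hc.hasType hG h
  have hF : G.Typed (.nonterminal F) (Ty.arrs τ.args .o) := by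
    rw [Ty.arrs_args]; exact .nonterminal (types_of_rules he)
  rw [code_apps hF hs, Ty.arrs_args]
  refine (conv_appsCode_codes hG he (forall₂_good_code hG hs)).trans ?_
  rw [code, hb.code_subst hs]
  rfl

theorem Typed.code_lt_two (hG : G.IsHORS) {t : Term} (h : G.Typed t .o) : G.code t < 2 :=
  (h.good hG).lt

/-- In a normal term, a non-terminal has fewer arguments than its arity, so only the arguments decide
on convergence. The statement about terminals is needed because they may have all their
arguments. -/
theorem Typed.conv_of_normal_aux (hG : G.IsHORS) {t : Term} {τ : Ty} (h : G.Typed t τ)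
    (hn : G.Normal t) : conv (G.code t) ∧
      ∀ a, t.head = .terminal a → G.code t = cst τ true fun _ => true := by
  induction t generalizing τ with
  | terminal a =>
    cases h
    refine ⟨?_, fun _ _ => rfl⟩
    rw [show G.code (.terminal a) = cst a.type true fun _ => true from rfl]
    cases a.type <;> simp [conv_cst_o, conv_cst_arr]
  | nonterminal F =>
    refine ⟨?_, fun a ha => by cases ha⟩
    cases h with
    | nonterminal h =>
      cases τ with
      | o =>
        obtain ⟨ts, e, hc, ht⟩ := exists_redex (F := F) rfl (X := []) (.nonterminal h)
        exact absurd ⟨_, _, _, hc, ht⟩ hn.not_isRedex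
      | arr a b => exact conv_codes h
  | var i => cases h with | var h => simp at h
  | app t s iht ihs =>
    cases h with
    | @app _ _ σ _ ht hs =>
      obtain ⟨ht1, ht2⟩ := iht ht hn.left
      obtain ⟨hs1, -⟩ := ihs hs hn.right
      have hcode : G.code (.app t s) = appCode σ τ (G.code t) (G.code s) := ht.code_app
      have hterm : ∀ a, t.head = .terminal a → G.code (.app t s) = cst τ true fun _ => true := by
        intro a ha
        rw [hcode, ht2 a ha, appCode_cst (Typed.good hG hs).lt, hs1]
        rfl
      refine ⟨?_, hterm⟩
      rcases ht.head_eq with ⟨a, ha⟩ | ⟨F, hF⟩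
      · rw [hterm a ha]
        cases τ <;> simp [conv_cst_o, conv_cst_arr]
      · cases τ with
        | o =>
          obtain ⟨ts, e, hc, hts⟩ := exists_redex (t := .app t s) hF (.app ht hs)
          exact absurd ⟨_, _, _, hc, hts⟩ hn.not_isRedex
        | arr a b =>
          rw [hcode, appCode, conv_mk_arr, ht1, hs1]
          rfl

/-- The code of a normal term says that the term converges. -/
theorem Typed.conv_of_normal (hG : G.IsHORS) {t : Term} {τ : Ty} (h : G.Typed t τ)
    (hn : G.Normal t) : conv (G.code t) := (h.conv_of_normal_aux hG hn).1

theorem all_conv_of_normal (hG : G.IsHORS) {ts : List Term} {as : List Ty}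
    (hs : List.Forall₂ G.Typed ts as) (hn : ∀ s ∈ ts, G.Normal s) :
    (ts.map G.code).all conv := by
  simp only [List.all_map, List.all_eq_true, Function.comp]
  intro t ht
  obtain ⟨i, hi, rfl⟩ := List.getElem_of_mem ht
  have := List.Forall₂.get hs hi (hs.length_eq ▸ hi)
  exact Typed.conv_of_normal hG this (hn _ ht)

/-- Innermost-outermost steps preserve codes. -/
theorem InnermostStep.code_eq (hG : G.IsHORS) {t t' : Term} {τ : Ty} (h : G.InnermostStep t t')
    (ht : G.Typed t τ) : G.code t = G.code t' := by
  induction h generalizing τ with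
  | redex hc hn =>
    have h2 := ht
    obtain ⟨σ, he, rfl, hs, hb⟩ := hc.hasType hG ht
    refine eq_of_conv_eq (ht.code_lt_two hG) (Typed.code_lt_two hG (hb.subst hs)) ?_
    rw [hc.conv_code hG h2, all_conv_of_normal hG hs hn, Bool.true_and]
  | left h ih =>
    cases ht with
    | app h1 h2 =>
      have h3 := ih h1
      rw [code] at h3 ⊢
      rw [h1.code_app, h3, code, code, (h.step.hasType hG h1).code_app]
  | right _ ih =>
    cases ht with
    | app h1 h2 =>
      have h3 := ih h2
      rw [code] at h3 ⊢
      rw [h1.code_app, h3, code, code, h1.code_app]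

/-! ### Adequacy: a term whose code says so has a normal form -/

/-- The logical relation between codes and normal terms: applied to related arguments, the term has
a normal form, again related, whenever the code says so. -/
def Val (G : Scheme) : Ty → ℕ → Term → Prop
  | .o, _, _ => True
  | .arr a b, d, t => ∀ x s, x < a.card → G.Normal s → Val G a x s → conv (appCode a b d x) →
      ∃ n, ReflTransGen G.InnermostStep (.app t s) n ∧ G.Normal n ∧ Val G b (appCode a b d x) n

/-- The extension of the logical relation to terms that need not be normal. -/
def Comp (G : Scheme) (τ : Ty) (d : ℕ) (t : Term) : Prop :=
  conv d → ∃ n, ReflTransGen G.InnermostStep t n ∧ G.Normal n ∧ G.Val τ d n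

/-- The logical relation on tuples. -/
inductive ValList (G : Scheme) : List Ty → List ℕ → List Term → Prop
  | nil : ValList G [] [] []
  | cons {a as x xs s ss} : x < Ty.card a → G.Normal s → G.Val a x s → ValList G as xs ss →
      ValList G (a :: as) (x :: xs) (s :: ss)

theorem ValList.getD {as : List Ty} {xs : List ℕ} {ss : List Term} (h : G.ValList as xs ss)
    {i : ℕ} {a : Ty} (hi : as[i]? = some a) (d : Term) :
    G.Normal (ss.getD i d) ∧ G.Val a (xs.getD i 0) (ss.getD i d) := by
  induction h generalizing i with
  | nil => simp at hi
  | cons _ h1 h2 _ ih =>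
    cases i with
    | zero => simp at hi; subst hi; simpa using ⟨h1, h2⟩
    | succ i => simp at hi; simpa using ih hi

theorem ValList.forall₂_lt {as : List Ty} {xs : List ℕ} {ss : List Term}
    (h : G.ValList as xs ss) : List.Forall₂ (fun (a : Ty) d => d < a.card) as xs := by
  induction h with
  | nil => exact .nil
  | cons h1 _ _ _ ih => exact .cons h1 ih

theorem ValList.normal {as : List Ty} {xs : List ℕ} {ss : List Term}
    (h : G.ValList as xs ss) : ∀ s ∈ ss, G.Normal s := by
  induction h with
  | nil => simp
  | cons _ h1 _ _ ih => simpa using ⟨h1, ih⟩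

theorem ValList.length_eq {as : List Ty} {xs : List ℕ} {ss : List Term}
    (h : G.ValList as xs ss) : ss.length = as.length := by
  induction h with
  | nil => rfl
  | cons _ _ _ _ ih => simp [ih]

theorem val_terminal {k : ℕ} {d : ℕ} {t : Term} {a : Terminal} (ht : t.head = .terminal a)
    (hn : G.Normal t) : G.Val (Ty.ofArity k) d t := by
  induction k generalizing d t with
  | zero => trivial
  | succ k ih =>
    intro x s _ hs _ _
    have h : G.Normal (.app t s) := normal_app hn hs (not_isRedex_of_head (a := a) ht)
    exact ⟨_, .refl, h, ih ht h⟩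

/-- The fundamental property of the logical relation. -/
theorem comp_subst {e : Term} {τ : Ty} {X : List Ty} {M env : List ℕ} {ts : List Term}
    (he : e.HasType G.terminals G.types X τ)
    (hlt : List.Forall₂ (fun (a : Ty) d => d < a.card) G.types M)
    (hM : ∀ F σ, G.types[F]? = some σ → G.Comp σ (M.getD F 0) (.nonterminal F))
    (henv : G.ValList X env ts) : G.Comp τ (e.code G.types M X env) (e.subst ts) := by
  induction he with
  | terminal => exact fun _ => ⟨_, .refl, normal_terminal _, val_terminal rfl (normal_terminal _)⟩
  | nonterminal h => exact hM _ _ h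
  | @var i _ h => exact fun _ => ⟨_, .refl, henv.getD h (.var i)⟩
  | @app t s a b ht hs iht ihs =>
    intro hc
    rw [ht.code_app] at hc ⊢
    obtain ⟨hc1, hc2⟩ := conv_of_conv_appCode hc
    obtain ⟨n, h1, h2, h3⟩ := iht hc1
    obtain ⟨m, h4, h5, h6⟩ := ihs hc2
    obtain ⟨r, h7, h8, h9⟩ := h3 _ m (hs.code_lt hlt henv.forall₂_lt) h5 h6 hc
    exact ⟨r, (innermost_app h1 h4).trans h7, h8, h9⟩

/-- A non-terminal that is applied to normal arguments `ps` is related to its code if its complete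
applications have normal forms whenever the results in the code say so. -/
theorem comp_cst {F : ℕ} {σ τ : Ty} {e : Term} {ps : List Term} {c : Bool} {h : List ℕ → Bool}
    (he : G.rules[F]? = some (σ, e)) (hps : ∀ s ∈ ps, G.Normal s)
    (hl : ps.length + τ.arity = σ.arity)
    (H : ∀ ds ss, G.ValList τ.args ds ss → h ds → ∃ n,
      ReflTransGen G.InnermostStep (((Term.nonterminal F).apps ps).apps ss) n ∧ G.Normal n) :
    G.Comp τ (cst τ c h) ((Term.nonterminal F).apps ps) := by
  induction τ generalizing ps c h with
  | o =>
    intro hc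
    rw [conv_cst_o, Bool.and_eq_true] at hc
    obtain ⟨n, h1, h2⟩ := H [] [] .nil hc.2
    exact ⟨n, h1, h2, trivial⟩
  | arr a b _ ih =>
    intro _
    have hl' : (Ty.arr a b).arity = b.arity + 1 := rfl
    refine ⟨_, .refl, normal_apps he (by omega) hps, fun x s hx hs hv => ?_⟩
    rw [appCode_cst hx, ← Term.apps_concat]
    refine ih ?_ ?_ fun ds ss hds hh => ?_
    · simp only [List.mem_append, List.mem_singleton]
      rintro r (hr | rfl)
      · exact hps r hr
      · exact hs
    · simp; omega
    · rw [Term.apps_concat]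
      exact H (x :: ds) (s :: ss) (.cons hx hs hv hds) hh

theorem comp_codesAt (hG : G.IsHORS) (n : ℕ) {F : ℕ} {σ : Ty} (hF : G.types[F]? = some σ) :
    G.Comp σ ((G.codesAt n).getD F 0) (.nonterminal F) := by
  have hF' := hF
  rw [types_getElem?, Option.map_eq_some_iff] at hF
  obtain ⟨⟨τ, e⟩, he, rfl⟩ := hF
  induction n generalizing F τ e with
  | zero =>
    intro hc
    simp [codesAt, conv] at hc
  | succ n ih =>
    rw [codesAt, getD_nextCodes he]
    refine comp_cst (ps := []) he (by simp) (by simp) fun ds ss hv hc => ?_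
    have hM : ∀ F σ, G.types[F]? = some σ → G.Comp σ ((G.codesAt n).getD F 0) (.nonterminal F) := by
      intro F σ h
      have h' := h
      rw [types_getElem?, Option.map_eq_some_iff] at h
      obtain ⟨⟨τ, e⟩, he, rfl⟩ := h
      exact ih _ _ he h'
    obtain ⟨m, h1, h2, -⟩ := comp_subst (hG.body _ (List.mem_of_getElem? he))
      ((forall₂_good_codesAt hG n).imp fun _ _ h => h.lt) hM hv hc
    refine ⟨m, .head (.redex ⟨τ, he, ?_⟩ hv.normal) h1, h2⟩
    exact hv.length_eq

/-- A closed term whose code says that it converges has a normal form. -/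
theorem exists_normal (hG : G.IsHORS) {t : Term} {τ : Ty} (h : G.Typed t τ)
    (hc : conv (G.code t)) : ∃ n, ReflTransGen G.InnermostStep t n ∧ G.Normal n := by
  obtain ⟨n, h1, h2, -⟩ := comp_subst h (forall₂_lt_codes hG)
    (fun F σ hF => comp_codesAt hG _ hF) .nil hc
  rw [Term.subst_nil] at h1
  exact ⟨n, h1, h2⟩

end Scheme

/-! ### The translation of types and terms -/

/-- The translation of types: an argument is replaced by all its versions. -/
def Ty.tr : Ty → Ty
  | .o => .o
  | .arr a b => Ty.arrs (List.replicate a.idx a.tr) b.tr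

/-- The position of the first version of the `i`-th non-terminal or variable, when the `j`-th one
has type `N j` and is replaced by `(N j).idx` versions. -/
def offset (N : List Ty) : ℕ → ℕ
  | 0 => 0
  | i + 1 => offset N i + (N.getD i .o).idx

/-- The versions of a term. A term of type `τ₁ → ⋯ → τₖ → o` has one version for each tuple of
codes of arguments, in the order given by `encode`, and this version is to be applied to arguments
with these codes. In an application, the code of the argument selects the versions of the function,
and the argument is passed on in all its versions. -/
def Term.versions (N : List Ty) (M : List ℕ) (X : List Ty) (env : List ℕ) : Term → List Term
  | .terminal a => List.replicate a.type.idx (.terminal a)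
  | .nonterminal F => (List.range (N.getD F .o).idx).map fun w => .nonterminal (offset N F + w)
  | .var i => (List.range (X.getD i .o).idx).map fun w => .var (offset X i + w)
  | .app t s => (List.range (t.inferTy N X).cod.idx).map fun w =>
      ((versions N M X env t).getD (s.code N M X env + (t.inferTy N X).dom.card * w)
        (.nonterminal 0)).apps (versions N M X env s)

theorem offset_cons (τ : Ty) (N : List Ty) (i : ℕ) :
    offset (τ :: N) (i + 1) = τ.idx + offset N i := by
  induction i with
  | zero => simp [offset]
  | succ i ih => rw [offset, ih, offset]; simp [add_assoc]

theorem offset_length {α β : Type*} {l : List α} {f : α → List β} {g : α → Ty}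
    (h : ∀ a ∈ l, (f a).length = (g a).idx) :
    (l.flatMap f).length = offset (l.map g) l.length := by
  induction l with
  | nil => rfl
  | cons a l ih =>
    rw [List.flatMap_cons, List.length_append, List.map_cons, List.length_cons, offset_cons,
      h a (by simp), ih fun b hb => h b (by simp [hb])]

theorem getElem?_flatMap {α β : Type*} {l : List α} {f : α → List β} {g : α → Ty}
    (h : ∀ a ∈ l, (f a).length = (g a).idx) {i : ℕ} {a : α} (hi : l[i]? = some a) {w : ℕ}
    (hw : w < (g a).idx) : (l.flatMap f)[offset (l.map g) i + w]? = (f a)[w]? := by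
  induction l generalizing i with
  | nil => simp at hi
  | cons b l ih =>
    have hb := h b (by simp)
    rw [List.flatMap_cons, List.map_cons]
    cases i with
    | zero =>
      simp only [List.getElem?_cons_zero, Option.some.injEq] at hi
      subst hi
      rw [offset, zero_add, List.getElem?_append_left (by omega)]
    | succ i =>
      rw [offset_cons, List.getElem?_append_right (by omega)]
      rw [show (g b).idx + offset (l.map g) i + w - (f b).length = offset (l.map g) i + w by omega]
      exact ih (fun c hc => h c (by simp [hc])) hi

namespace Ty

theorem args_tr (τ : Ty) :
    τ.tr.args = τ.args.flatMap fun a => List.replicate a.idx a.tr := by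
  induction τ with
  | o => rfl
  | arr a b _ ih => rw [tr, args_arrs, ih]; rfl

theorem tr_ofArity (k : ℕ) : (ofArity k).tr = ofArity k := by
  induction k with
  | zero => rfl
  | succ k ih => simp [ofArity, tr, ih, arrs]

theorem arrs_ne_o {as : List Ty} {τ : Ty} (h : τ ≠ o) : arrs as τ ≠ o := by
  cases as with
  | nil => exact h
  | cons a as => simp [arrs]

theorem tr_arr_ne_o (a b : Ty) : (arr a b).tr ≠ o := by
  obtain ⟨n, hn⟩ := Nat.exists_eq_succ_of_ne_zero a.idx_pos.ne'
  rw [tr, hn, List.replicate_succ]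
  simp [arrs]

theorem order_arrs_replicate (n : ℕ) (a b : Ty) :
    (arrs (List.replicate (n + 1) a) b).order = max (a.order + 1) b.order := by
  induction n with
  | zero => rfl
  | succ n ih =>
    rw [List.replicate_succ]
    change max (a.order + 1) (arrs (List.replicate (n + 1) a) b).order = _
    rw [ih, ← max_assoc, max_self]

/-- The translation preserves the order, because each argument has at least one version. -/
theorem order_tr (τ : Ty) : τ.tr.order = τ.order := by
  induction τ with
  | o => rfl
  | arr a b iha ihb =>
    obtain ⟨n, hn⟩ := Nat.exists_eq_succ_of_ne_zero a.idx_pos.ne'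
    rw [tr, hn, order_arrs_replicate, iha, ihb, order]

end Ty

namespace Term

variable {Sig : List Terminal} {N X : List Ty} {M env : List ℕ}

theorem HasType.length_versions {t : Term} {τ : Ty} (h : HasType Sig N X t τ) :
    (t.versions N M X env).length = τ.idx := by
  cases h with
  | terminal => simp [versions]
  | nonterminal h => simp [versions, h]
  | var h => simp [versions, h]
  | app h _ => simp [versions, h.inferTy_eq, Ty.cod]

theorem HasType.versions_app {t s : Term} {σ τ : Ty} (h : HasType Sig N X t (.arr σ τ)) :
    (Term.app t s).versions N M X env = (List.range τ.idx).map fun w =>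
      ((t.versions N M X env).getD (s.code N M X env + σ.card * w) (.nonterminal 0)).apps
        (s.versions N M X env) := by
  rw [versions, h.inferTy_eq]
  rfl

theorem getD_mem {α : Type*} {l : List α} {i : ℕ} (h : i < l.length) (d : α) :
    l.getD i d ∈ l := by
  simp [List.getD_eq_getElem?_getD, h]

/-- The version that is selected in an application is a version. -/
theorem HasType.getD_versions_mem {t s : Term} {σ τ : Ty} (ht : HasType Sig N X t (.arr σ τ))
    (hs : s.code N M X env < σ.card) {w : ℕ} (hw : w < τ.idx) :
    (t.versions N M X env).getD (s.code N M X env + σ.card * w) (.nonterminal 0) ∈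
      t.versions N M X env := by
  refine getD_mem ?_ _
  rw [ht.length_versions]
  exact Ty.add_mul_lt hs hw

/-- Versions have the translated type. -/
theorem HasType.hasType_versions {N' : List Ty} {t : Term} {τ : Ty} (h : HasType Sig N X t τ)
    (hM : List.Forall₂ (fun (a : Ty) d => d < a.card) N M)
    (hX : List.Forall₂ (fun (a : Ty) d => d < a.card) X env)
    (hN : ∀ F σ w, N[F]? = some σ → w < σ.idx → N'[offset N F + w]? = some σ.tr) :
    ∀ v ∈ t.versions N M X env,
      HasType Sig N' (X.flatMap fun a => List.replicate a.idx a.tr) v τ.tr := by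
  induction h with
  | @terminal a h =>
    intro v hv
    rw [versions, List.mem_replicate] at hv
    rw [hv.2, Terminal.type, Ty.tr_ofArity]
    exact .terminal h
  | @nonterminal F σ h =>
    intro v hv
    simp only [versions, List.getD_eq_getElem?_getD, h, Option.getD_some, List.mem_map,
      List.mem_range] at hv
    obtain ⟨w, hw, rfl⟩ := hv
    exact .nonterminal (hN F σ w h hw)
  | @var i σ h =>
    intro v hv
    simp only [versions, List.getD_eq_getElem?_getD, h, Option.getD_some, List.mem_map,
      List.mem_range] at hv
    obtain ⟨w, hw, rfl⟩ := hv
    refine .var ?_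
    have := getElem?_flatMap (l := X) (f := fun a : Ty => List.replicate a.idx a.tr) (g := id)
      (by simp) h hw
    rw [List.map_id] at this
    rw [this, List.getElem?_replicate]
    exact if_pos hw
  | @app t s σ τ ht hs iht ihs =>
    intro v hv
    rw [ht.versions_app] at hv
    simp only [List.mem_map, List.mem_range] at hv
    obtain ⟨w, hw, rfl⟩ := hv
    refine hasType_apps (iht _ (ht.getD_versions_mem (hs.code_lt hM hX) hw)) ?_
    rw [List.forall₂_iff_get]
    refine ⟨by rw [hs.length_versions, List.length_replicate], fun i h1 h2 => ?_⟩
    simpa using ihs _ (List.getElem_mem h1)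

theorem eq_range_map_getD {α : Type*} {l : List α} {n : ℕ} (h : l.length = n) (d : α) :
    l = (List.range n).map fun w => l.getD w d := by
  subst h
  refine List.ext_getElem (by simp) fun i h1 h2 => ?_
  simp [List.getD_eq_getElem?_getD, h1]

/-- The versions of an instance of a term are the instances of its versions. -/
theorem HasType.versions_subst {e : Term} {ts : List Term} {τ : Ty} (h : HasType Sig N X e τ)
    (hs : List.Forall₂ (HasType Sig N []) ts X) :
    (e.subst ts).versions N M [] [] =
      (e.versions N M X (ts.map (Term.code N M [] []))).map
        (Term.subst (ts.flatMap (Term.versions N M [] []))) := by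
  have hty : ts.map (inferTy N []) = X := by
    clear h
    induction hs with
    | nil => rfl
    | cons h1 _ ih => rw [List.map_cons, h1.inferTy_eq, ih]
  have hlen : ∀ t ∈ ts, (t.versions N M [] []).length = (t.inferTy N []).idx := by
    intro t ht
    obtain ⟨i, hi, rfl⟩ := List.getElem_of_mem ht
    have := List.Forall₂.get hs hi (hs.length_eq ▸ hi)
    rw [List.get_eq_getElem] at this
    rw [this.length_versions, this.inferTy_eq]
  induction h with
  | terminal => simp [versions, Term.subst]
  | nonterminal => simp [versions, Term.subst]
  | @var i σ h =>
    have hi : i < ts.length := hs.length_eq ▸ (List.getElem?_eq_some_iff.1 h).1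
    have hi' : ts[i]? = some ts[i] := List.getElem?_eq_getElem hi
    have hσ : (ts[i]).inferTy N [] = σ := by
      rw [← hty, List.getElem?_map, hi'] at h
      simpa using h
    have hl := hlen _ (List.getElem_mem hi)
    simp only [versions, List.map_map, Term.subst, List.getD_eq_getElem?_getD, h, hi',
      Option.getD_some]
    rw [eq_range_map_getD hl (.var 0), hσ]
    refine List.map_congr_left fun w hw => ?_
    rw [List.mem_range] at hw
    have := getElem?_flatMap hlen hi' (w := w) (by rwa [hσ])
    rw [hty] at this
    have hw' : w < ((ts[i]).versions N M [] []).length := by rwa [hl, hσ]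
    simp [Term.subst, List.getD_eq_getElem?_getD, this, hw']
  | @app t s σ τ ht hs' iht ihs =>
    rw [Term.subst, (ht.subst hs).versions_app, ht.versions_app, List.map_map, iht, ihs,
      hs'.code_subst hs]
    refine List.map_congr_left fun w hw => ?_
    rw [Function.comp, subst_apps]
    congr 1
    exact List.getD_map _ (Term.nonterminal 0) _

end Term

namespace Scheme

/-! ### The self-correcting scheme -/

/-- The position of the additional non-terminal `Ω` with the rule `Ω → Ω`. -/
def voidIndex (G : Scheme) : ℕ := offset G.types G.types.length

/-- The right-hand side of the rule for the version number `w` of a non-terminal `F` with the rule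
`p = (τ, e)`. In an innermost-outermost derivation, `F` is not contracted unless all its arguments
converge. Therefore `Ω` is the right-hand side if the codes given by `w` say that one of the
arguments diverges. -/
def versionBody (G : Scheme) (p : Ty × Term) (w : ℕ) : Term :=
  if (decode p.1.args w).all conv then
    (p.2.versions G.types G.codes p.1.args (decode p.1.args w)).getD 0 (.nonterminal G.voidIndex)
  else .nonterminal G.voidIndex

/-- The self-correcting scheme. -/
def correct (G : Scheme) : Scheme where
  terminals := G.terminals
  rules := (G.rules.flatMap fun p => (List.range p.1.idx).map fun w => (p.1.tr, G.versionBody p w))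
    ++ [(.o, .nonterminal G.voidIndex)]
  start := offset G.types G.start

/-- The versions of a closed term. -/
def lift (G : Scheme) (t : Term) : List Term := t.versions G.types G.codes [] []

variable {G : Scheme}

theorem correct_rules_version {F w : ℕ} {τ : Ty} {e : Term} (he : G.rules[F]? = some (τ, e))
    (hw : w < τ.idx) :
    G.correct.rules[offset G.types F + w]? = some (τ.tr, G.versionBody (τ, e) w) := by
  have h1 : (G.rules.flatMap fun p =>
      (List.range p.1.idx).map fun w => (p.1.tr, G.versionBody p w))[offset G.types F + w]? =
      some (τ.tr, G.versionBody (τ, e) w) := by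
    have := getElem?_flatMap (l := G.rules) (g := Prod.fst)
      (f := fun p => (List.range p.1.idx).map fun w => (p.1.tr, G.versionBody p w))
      (by simp) he hw
    rw [types, this]
    simp [hw]
  exact List.getElem?_append_left (List.getElem?_eq_some_iff.1 h1).1 |>.trans h1

theorem correct_rules_void :
    G.correct.rules[G.voidIndex]? = some (.o, .nonterminal G.voidIndex) := by
  have := offset_length (l := G.rules) (g := Prod.fst)
    (f := fun p => (List.range p.1.idx).map fun w => (p.1.tr, G.versionBody p w)) (by simp)
  have h : G.voidIndex = (G.rules.flatMap fun p =>
      (List.range p.1.idx).map fun w => (p.1.tr, G.versionBody p w)).length := by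
    rw [this]; simp [voidIndex, types]
  exact (congrArg (G.correct.rules[·]?) h).trans List.getElem?_concat_length

theorem correct_types_version {F w : ℕ} {τ : Ty} (h : G.types[F]? = some τ) (hw : w < τ.idx) :
    G.correct.types[offset G.types F + w]? = some τ.tr := by
  rw [types_getElem?, Option.map_eq_some_iff] at h
  obtain ⟨⟨τ, e⟩, he, rfl⟩ := h
  rw [types_getElem? G.correct, correct_rules_version he hw]
  rfl

theorem correct_types_void : G.correct.types[G.voidIndex]? = some .o := by
  rw [types_getElem? G.correct, correct_rules_void]
  rfl

theorem isHORS_correct (hG : G.IsHORS) : G.correct.IsHORS where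
  body := by
    intro p hp
    have hvoid : ∀ X, Term.HasType G.correct.terminals G.correct.types X
        (.nonterminal G.voidIndex) .o := fun X => .nonterminal correct_types_void
    simp only [correct, List.mem_append, List.mem_flatMap, List.mem_map, List.mem_range,
      List.mem_singleton] at hp
    rcases hp with ⟨q, hq, w, hw, rfl⟩ | rfl
    · have hb := hG.body q hq
      simp only [versionBody]
      split_ifs
      · have := hb.hasType_versions (forall₂_lt_codes hG) (forall₂_decode q.1.args w)
          (N' := G.correct.types) fun F σ w h hw => correct_types_version h hw
        rw [← Ty.args_tr] at this
        refine this _ (Term.getD_mem ?_ _)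
        rw [hb.length_versions, Ty.idx_o]
        exact Nat.one_pos
      · exact hvoid _
    · exact hvoid _
  start := by
    have := correct_types_version (w := 0) hG.start (by simp)
    simpa [correct, Ty.tr] using this

theorem foldr_max_le {l : List ℕ} {n : ℕ} : l.foldr max 0 ≤ n ↔ ∀ m ∈ l, m ≤ n := by
  induction l with
  | nil => simp
  | cons a l ih => simp [ih]

theorem order_correct (G : Scheme) : G.correct.order = G.order := by
  refine eq_of_forall_ge_iff fun n => ?_
  simp only [order, foldr_max_le, types, List.map_map, List.mem_map, forall_exists_index, and_imp,
    forall_apply_eq_imp_iff₂, Function.comp]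
  constructor
  · intro h p hp
    rw [← Ty.order_tr]
    refine h (p.1.tr, G.versionBody p 0) ?_
    simp only [correct, List.mem_append, List.mem_flatMap, List.mem_map, List.mem_range]
    exact Or.inl ⟨p, hp, 0, p.1.idx_pos, rfl⟩
  · intro h p hp
    simp only [correct, List.mem_append, List.mem_flatMap, List.mem_map, List.mem_range,
      List.mem_singleton] at hp
    rcases hp with ⟨q, hq, w, hw, rfl⟩ | rfl
    · exact (Ty.order_tr _).trans_le (h q hq)
    · exact Nat.zero_le _

/-! ### Simulation of innermost-outermost derivations -/

theorem Typed.length_lift {t : Term} {τ : Ty} (h : G.Typed t τ) : (G.lift t).length = τ.idx :=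
  h.length_versions

theorem Typed.hasType_lift (hG : G.IsHORS) {t : Term} {τ : Ty} (h : G.Typed t τ) :
    ∀ v ∈ G.lift t, G.correct.Typed v τ.tr :=
  h.hasType_versions (forall₂_lt_codes hG) .nil fun _ _ _ h hw => correct_types_version h hw

theorem Typed.lift_app {t s : Term} {σ τ : Ty} (h : G.Typed t (.arr σ τ)) :
    G.lift (.app t s) = (List.range τ.idx).map fun w =>
      ((G.lift t).getD (G.code s + σ.card * w) (.nonterminal 0)).apps (G.lift s) :=
  h.versions_app

theorem Typed.mem_lift_app (hG : G.IsHORS) {t s v : Term} {σ τ : Ty} (h : G.Typed t (.arr σ τ))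
    (hs : G.Typed s σ) (hv : v ∈ G.lift (.app t s)) : ∃ u ∈ G.lift t, v = u.apps (G.lift s) := by
  rw [h.lift_app] at hv
  simp only [List.mem_map, List.mem_range] at hv
  obtain ⟨w, hw, rfl⟩ := hv
  exact ⟨_, h.getD_versions_mem (Typed.good hG hs).lt hw, rfl⟩

/-- The version of an iterated application that is to be applied to no further arguments. -/
theorem lift_apps (hG : G.IsHORS) {t : Term} {ts : List Term} {τ : Ty} (h : G.Typed t τ)
    (hs : List.Forall₂ G.Typed ts τ.args) :
    (G.lift (t.apps ts)).getD 0 (.nonterminal 0) =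
      ((G.lift t).getD (encode τ.args (ts.map G.code)) (.nonterminal 0)).apps
        (ts.flatMap G.lift) := by
  induction τ generalizing t ts with
  | o => rw [Ty.args] at hs; cases hs; rfl
  | arr a b _ ih =>
    rw [Ty.args] at hs
    cases hs with
    | @cons s _ ss _ h1 h2 =>
      have hlt : encode b.args (ss.map G.code) < b.idx :=
        encode_lt ((forall₂_good_code hG h2).imp fun _ _ h => h.lt)
      refine (ih (t := .app t s) (.app h h1) h2).trans ?_
      rw [h.lift_app, List.flatMap_cons, Term.apps_append, Ty.args, List.map_cons, encode]
      simp [List.getD_eq_getElem?_getD, hlt]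

theorem Typed.lift_eq_singleton {t : Term} (h : G.Typed t .o) :
    G.lift t = [(G.lift t).getD 0 (.nonterminal 0)] := by
  have := h.length_lift
  rw [Ty.idx_o, List.length_eq_one_iff] at this
  obtain ⟨v, hv⟩ := this
  rw [hv]
  rfl

/-- The number of the version of a non-terminal that is to be applied to the given arguments. -/
def versionIndex (G : Scheme) (F : ℕ) (τ : Ty) (ts : List Term) : ℕ :=
  offset G.types F + encode τ.args (ts.map G.code)

theorem encode_code_lt (hG : G.IsHORS) {ts : List Term} {τ : Ty}
    (hs : List.Forall₂ G.Typed ts τ.args) : encode τ.args (ts.map G.code) < τ.idx :=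
  encode_lt ((forall₂_good_code hG hs).imp fun _ _ h => h.lt)

theorem lift_redex (hG : G.IsHORS) {F : ℕ} {τ : Ty} {e : Term} {ts : List Term}
    (he : G.rules[F]? = some (τ, e)) (hs : List.Forall₂ G.Typed ts τ.args) :
    G.lift ((Term.nonterminal F).apps ts) =
      [(Term.nonterminal (G.versionIndex F τ ts)).apps (ts.flatMap G.lift)] := by
  have hF : G.Typed (.nonterminal F) τ := .nonterminal (types_of_rules he)
  have hF' : G.Typed (.nonterminal F) (Ty.arrs τ.args .o) := by rwa [Ty.arrs_args]
  rw [Typed.lift_eq_singleton (Term.hasType_apps hF' hs), lift_apps hG hF hs]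
  have := encode_code_lt hG hs
  simp [lift, Term.versions, List.getD_eq_getElem?_getD, types_of_rules he, this, versionIndex]

theorem length_flatMap_lift {ts : List Term} {as : List Ty} (hs : List.Forall₂ G.Typed ts as) :
    (ts.flatMap G.lift).length = (as.flatMap fun a => List.replicate a.idx a.tr).length := by
  induction hs with
  | nil => rfl
  | cons h1 _ ih => simp [h1.length_lift, ← ih, List.length_flatMap]

theorem correct_contracts (hG : G.IsHORS) {F : ℕ} {τ : Ty} {e : Term} {ts : List Term}
    (he : G.rules[F]? = some (τ, e)) (hs : List.Forall₂ G.Typed ts τ.args) :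
    G.correct.Contracts (G.versionIndex F τ ts) (ts.flatMap G.lift)
      (G.versionBody (τ, e) (encode τ.args (ts.map G.code))) :=
  ⟨τ.tr, correct_rules_version he (encode_code_lt hG hs), by
    rw [length_flatMap_lift hs, Ty.arity, Ty.args_tr]⟩

/-- If all arguments converge, a version of a redex is contracted to a version of the
contractum. -/
theorem lift_subst (hG : G.IsHORS) {F : ℕ} {τ : Ty} {e : Term} {ts : List Term}
    (he : G.rules[F]? = some (τ, e)) (hs : List.Forall₂ G.Typed ts τ.args)
    (hc : (ts.map G.code).all conv) :
    G.lift (e.subst ts) = [(G.versionBody (τ, e) (encode τ.args (ts.map G.code))).subst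
      (ts.flatMap G.lift)] := by
  have hb := hG.body _ (List.mem_of_getElem? he)
  have hlen : (e.versions G.types G.codes τ.args (ts.map G.code)).length = 1 := hb.length_versions
  obtain ⟨v, hv⟩ := List.length_eq_one_iff.1 hlen
  have hd : decode τ.args (encode τ.args (ts.map G.code)) = ts.map G.code :=
    decode_encode ((forall₂_good_code hG hs).imp fun _ _ h => h.lt)
  have h1 : G.versionBody (τ, e) (encode τ.args (ts.map G.code)) = v := by
    simp only [versionBody, hd, hc, hv]
    rfl
  rw [h1]
  refine (hb.versions_subst hs).trans ?_
  rw [show e.versions G.types G.codes τ.args (ts.map (Term.code G.types G.codes [] [])) = [v]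
    from hv]
  rfl

theorem head_lift (hG : G.IsHORS) {t : Term} {τ : Ty} {a : Terminal} (h : G.Typed t τ)
    (ht : t.head = .terminal a) : ∀ v ∈ G.lift t, v.head = .terminal a := by
  induction t generalizing τ with
  | terminal b =>
    intro v hv
    rw [lift, Term.versions, List.mem_replicate] at hv
    rw [hv.2, ht]
  | nonterminal F => cases ht
  | var i => cases ht
  | app t s iht _ =>
    intro v hv
    cases h with
    | app h1 h2 =>
      obtain ⟨u, hu, rfl⟩ := Typed.mem_lift_app hG h1 h2 hv
      rw [Term.head_apps]
      exact iht h1 ht u hu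

theorem head_lift_nonterminal (hG : G.IsHORS) {t : Term} {τ : Ty} {F : ℕ} (h : G.Typed t τ)
    (ht : t.head = .nonterminal F) : ∀ v ∈ G.lift t, ∃ F', v.head = .nonterminal F' := by
  induction t generalizing τ with
  | terminal b => cases ht
  | nonterminal F =>
    intro v hv
    simp only [lift, Term.versions, List.mem_map] at hv
    obtain ⟨w, -, rfl⟩ := hv
    exact ⟨_, rfl⟩
  | var i => cases ht
  | app t s iht _ =>
    intro v hv
    cases h with
    | app h1 h2 =>
      obtain ⟨u, hu, rfl⟩ := Typed.mem_lift_app hG h1 h2 hv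
      rw [Term.head_apps]
      exact iht h1 ht u hu

theorem normal_apps_of_prefix {v : Term} {ss : List Term} (hv : G.Normal v)
    (hs : ∀ s ∈ ss, G.Normal s) (h : ∀ us, us <+: ss → us ≠ [] → ¬ G.IsRedex (v.apps us)) :
    G.Normal (v.apps ss) := by
  induction ss using List.reverseRecOn with
  | nil => exact hv
  | append_singleton l s ih =>
    have h2 := h _ (List.prefix_refl _) (by simp)
    rw [Term.apps_concat] at h2 ⊢
    exact normal_app (ih (fun s hs' => hs s (by simp [hs'])) fun us hu =>
      h us (hu.trans (List.prefix_append _ _))) (hs s (by simp)) h2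

theorem not_isRedex_of_ne_o (hG : G.IsHORS) {t : Term} {τ : Ty} (h : G.Typed t τ)
    (hτ : τ ≠ .o) : ¬ G.IsRedex t := fun hr => hτ (hr.eq_o hG h)

/-- The versions of a normal term are normal. -/
theorem normal_lift (hG : G.IsHORS) {t : Term} {τ : Ty} (h : G.Typed t τ) (hn : G.Normal t) :
    ∀ v ∈ G.lift t, G.correct.Normal v := by
  induction t generalizing τ with
  | terminal b =>
    intro v hv
    rw [lift, Term.versions, List.mem_replicate] at hv
    rw [hv.2]
    exact normal_terminal b
  | nonterminal F =>
    intro v hv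
    have hv' := Typed.hasType_lift hG h v hv
    cases τ with
    | o =>
      obtain ⟨ts, e, hc, ht⟩ := exists_redex (F := F) rfl h
      exact absurd ⟨_, _, _, hc, ht⟩ hn.not_isRedex
    | arr a b =>
      have hr := not_isRedex_of_ne_o (isHORS_correct hG) hv' (Ty.tr_arr_ne_o a b)
      simp only [lift, Term.versions, List.mem_map] at hv
      obtain ⟨w, -, rfl⟩ := hv
      exact normal_nonterminal hr
  | var i => cases h with | var h => simp at h
  | app t s iht ihs =>
    intro v hv
    have hv' := Typed.hasType_lift hG h v hv
    have h0 := h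
    cases h with
    | @app _ _ σ _ ht hs =>
      obtain ⟨u, hu, rfl⟩ := Typed.mem_lift_app hG ht hs hv
      refine normal_apps_of_prefix (iht ht hn.left u hu) (ihs hs hn.right) fun us hus _ => ?_
      rcases ht.head_eq with ⟨a, ha⟩ | ⟨F, hF⟩
      · refine not_isRedex_of_head (a := a) ?_
        rw [Term.head_apps]
        exact head_lift hG ht ha u hu
      · cases τ with
        | o =>
          obtain ⟨ts, e, hc, hts⟩ := exists_redex (t := .app t s) hF h0
          exact absurd ⟨_, _, _, hc, hts⟩ hn.not_isRedex
        | arr a b =>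
          obtain ⟨rs, hrs⟩ := hus
          rw [← hrs, Term.apps_append] at hv'
          obtain ⟨as, -, h2⟩ := hv'.apps_inv
          exact not_isRedex_of_ne_o (isHORS_correct hG) h2 (Ty.arrs_ne_o (Ty.tr_arr_ne_o a b))

theorem normal_flatMap_lift (hG : G.IsHORS) {ts : List Term} {as : List Ty}
    (hs : List.Forall₂ G.Typed ts as) (hn : ∀ s ∈ ts, G.Normal s) :
    ∀ v ∈ ts.flatMap G.lift, G.correct.Normal v := by
  intro v hv
  obtain ⟨s, hst, hv⟩ := List.mem_flatMap.1 hv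
  obtain ⟨i, hi, rfl⟩ := List.getElem_of_mem hst
  exact normal_lift hG (List.Forall₂.get hs hi (hs.length_eq ▸ hi)) (hn _ hst) v hv

/-- An innermost-outermost step of `G` is simulated in each version by innermost-outermost
derivations of the self-correcting scheme. -/
theorem InnermostStep.lift (hG : G.IsHORS) {t t' : Term} {τ : Ty} (h : G.InnermostStep t t')
    (ht : G.Typed t τ) :
    List.Forall₂ (ReflTransGen G.correct.InnermostStep) (G.lift t) (G.lift t') := by
  induction h generalizing τ with
  | redex hc hn =>
    obtain ⟨σ, he, rfl, hs, -⟩ := hc.hasType hG ht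
    rw [lift_redex hG he hs, lift_subst hG he hs (all_conv_of_normal hG hs hn)]
    refine .cons (.single (.redex (correct_contracts hG he hs) ?_)) .nil
    exact normal_flatMap_lift hG hs hn
  | left h ih =>
    cases ht with
    | app h1 h2 =>
      rw [Typed.lift_app h1, Typed.lift_app (h.step.hasType hG h1)]
      refine forall₂_map fun w _ => innermost_apps ?_ (List.forall₂_same.2 fun _ _ => .refl)
      exact getD_forall₂ (ih h1) .refl _
  | right h ih =>
    cases ht with
    | app h1 h2 =>
      rw [Typed.lift_app h1, Typed.lift_app h1, h.code_eq hG h2]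
      exact forall₂_map fun w _ => innermost_apps .refl (ih h2)

theorem forall₂_trans {α : Type*} {r : α → α → Prop} {l l' l'' : List α}
    (h : List.Forall₂ (ReflTransGen r) l l') (h' : List.Forall₂ (ReflTransGen r) l' l'') :
    List.Forall₂ (ReflTransGen r) l l'' := by
  induction h generalizing l'' with
  | nil => exact h'
  | cons h1 _ ih => cases h' with | cons h2 h' => exact .cons (h1.trans h2) (ih h')

theorem lift_of_innermost (hG : G.IsHORS) {t t' : Term} {τ : Ty} (ht : G.Typed t τ)
    (h : ReflTransGen G.InnermostStep t t') :
    G.code t = G.code t' ∧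
      List.Forall₂ (ReflTransGen G.correct.InnermostStep) (G.lift t) (G.lift t') := by
  induction h with
  | refl => exact ⟨rfl, List.forall₂_same.2 fun _ _ => .refl⟩
  | tail h1 h2 ih =>
    have := hasType_of_innermost hG h1 ht
    exact ⟨ih.1.trans (h2.code_eq hG this), forall₂_trans ih.2 (h2.lift hG this)⟩

/-- A closed term and its versions have the same `⊥`-transformation. -/
theorem botTransformAux_lift (hG : G.IsHORS) {t : Term} {τ : Ty} (h : G.Typed t τ) :
    ∀ v ∈ G.lift t, ∀ ts, v.botTransformAux ts = t.botTransformAux ts := by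
  induction t generalizing τ with
  | terminal a =>
    intro v hv ts
    rw [lift, Term.versions, List.mem_replicate] at hv
    rw [hv.2]
  | nonterminal F =>
    intro v hv ts
    simp only [lift, Term.versions, List.mem_map] at hv
    obtain ⟨w, -, rfl⟩ := hv
    rfl
  | var i => cases h with | var h => simp at h
  | app t s iht ihs =>
    intro v hv ts
    cases h with
    | @app _ _ σ _ ht hs =>
      obtain ⟨u, hu, rfl⟩ := Typed.mem_lift_app hG ht hs hv
      rcases ht.head_eq with ⟨a, ha⟩ | ⟨F, hF⟩
      · -- A terminal has arguments of ground type, which have a single version.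
        obtain rfl := ht.dom_eq_o_of_head ha
        obtain ⟨r, hr⟩ : ∃ r, G.lift s = [r] := ⟨_, Typed.lift_eq_singleton hs⟩
        have hrs := ihs hs r (by rw [hr]; exact List.mem_singleton_self r) []
        rw [hr]
        change u.botTransformAux (r.botTransformAux [] :: ts) =
          t.botTransformAux (s.botTransformAux [] :: ts)
        rw [iht ht u hu, hrs]
      · obtain ⟨F', hF'⟩ := head_lift_nonterminal hG ht hF u hu
        rw [botTransformAux_of_head (t := .app t s) hF,
          botTransformAux_of_head (F := F') (by rw [Term.head_apps, hF'])]

/-! ### Unrestricted derivations of the self-correcting scheme -/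

theorem ParN.app_inv {n : ℕ} {t s q : Term} {a : Terminal} (ht : t.head = .terminal a)
    (h : G.ParN n (.app t s) q) :
    ∃ t' s', q = .app t' s' ∧ G.ParN n t t' ∧ G.ParN n s s' := by
  induction n generalizing t s with
  | zero => cases h; exact ⟨_, _, rfl, rfl, rfl⟩
  | succ n ih =>
    obtain ⟨p, h1, h2⟩ := h
    -- A head that is a terminal is never reduced.
    have key : ∀ {t t'}, t.head = .terminal a → G.Par t t' → t'.head = .terminal a := by
      intro t t' ht h
      obtain ⟨k, hk⟩ : ∃ k, k = sizeOf t := ⟨_, rfl⟩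
      induction k using Nat.strong_induction_on generalizing t t' with
      | _ k ih =>
        cases h with
        | refl => exact ht
        | @app t₁ t₁' _ _ h1 =>
          simp only [Term.app.sizeOf_spec] at hk
          exact ih (sizeOf t₁) (by omega) (t := t₁) (t' := t₁') ht h1 rfl
        | redex hc => rw [Term.head_apps] at ht; cases ht
    generalize h0 : Term.app t s = r at h1
    cases h1 with
    | refl =>
      subst h0
      obtain ⟨t', s', rfl, h3, h4⟩ := ih ht h2
      exact ⟨t', s', rfl, ⟨_, .refl _, h3⟩, ⟨_, .refl _, h4⟩⟩
    | app h5 h6 =>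
      rw [Term.app.injEq] at h0
      obtain ⟨rfl, rfl⟩ := h0
      obtain ⟨t', s', rfl, h3, h4⟩ := ih (key ht h5) h2
      exact ⟨t', s', rfl, ⟨_, h5, h3⟩, ⟨_, h6, h4⟩⟩
    | redex hc =>
      have := congrArg Term.head h0
      rw [Term.head_apps] at this
      exact absurd (ht.symm.trans this) (by simp [Term.head])

theorem ParN.eq_of_normal {n : ℕ} {t q : Term} (h : G.ParN n t q) (ht : G.Normal t) : q = t := by
  induction n with
  | zero => exact h.symm
  | succ n ih =>
    obtain ⟨p, h1, h2⟩ := h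
    rw [h1.eq_of_normal ht] at h2
    exact ih h2

/-- A redex that is contracted to `Ω` produces nothing. -/
theorem ParN.bot_of_void {i n : ℕ} {us : List Term} {q : Term}
    (hi : G.correct.Contracts i us (.nonterminal G.voidIndex))
    (h : G.correct.ParN n ((Term.nonterminal i).apps us) q) (ts : List Tree) :
    q.botTransformAux ts = Tree.bot := by
  induction n generalizing i us with
  | zero => cases h; exact botTransformAux_of_head (Term.head_apps _ _) _
  | succ n ih =>
    obtain ⟨p, h1, h2⟩ := h
    rcases h1.inv_apps hi.length_le with ⟨us', hu, rfl⟩ | ⟨e, us', hc, hu, rfl⟩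
    · exact ih (hi.congr hu.length_eq.symm) h2
    · rw [hc.unique hi] at h2
      exact ih (i := G.voidIndex) (us := []) ⟨.o, correct_rules_void, rfl⟩ h2

/-- Parallel reductions of a redex with normal arguments leave it as it is until they
contract it. -/
theorem ParN.redex_inv {i n : ℕ} {us : List Term} {e q : Term} (hi : G.Contracts i us e)
    (hn : ∀ u ∈ us, G.Normal u) (h : G.ParN n ((Term.nonterminal i).apps us) q) :
    q = (Term.nonterminal i).apps us ∨ ∃ m < n, G.ParN m (e.subst us) q := by
  have hus : ∀ {us'}, List.Forall₂ G.Par us us' → us' = us := by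
    intro us' hu
    refine List.ext_getElem hu.length_eq.symm fun k h1 h2 => ?_
    exact (List.Forall₂.get hu h2 h1).eq_of_normal (hn _ (List.getElem_mem h2))
  induction n with
  | zero => exact Or.inl h.symm
  | succ n ih =>
    obtain ⟨p, h1, h2⟩ := h
    rcases h1.inv_apps hi.length_le with ⟨us', hu, rfl⟩ | ⟨e', us', hc, hu, rfl⟩
    · rw [hus hu] at h2
      rcases ih h2 with h | ⟨m, hm, h⟩
      · exact Or.inl h
      · exact Or.inr ⟨m, by omega, h⟩
    · rw [hus hu, hc.unique hi] at h2
      exact Or.inr ⟨n, by omega, h2⟩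

theorem exists_normal_list (hG : G.IsHORS) {ts : List Term} {as : List Ty}
    (hs : List.Forall₂ G.Typed ts as) (hc : (ts.map G.code).all conv) :
    ∃ ns, List.Forall₂ (ReflTransGen G.InnermostStep) ts ns ∧ (∀ n ∈ ns, G.Normal n) ∧
      List.Forall₂ G.Typed ns as ∧ ns.map G.code = ts.map G.code := by
  induction hs with
  | nil => exact ⟨[], .nil, by simp, .nil, rfl⟩
  | cons h1 _ ih =>
    simp only [List.map_cons, List.all_cons, Bool.and_eq_true] at hc
    obtain ⟨ns, h2, h3, h4, h5⟩ := ih hc.2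
    obtain ⟨n, h6, h7⟩ := exists_normal hG h1 hc.1
    refine ⟨n :: ns, .cons h6 h2, by simpa using ⟨h7, h3⟩,
      .cons (hasType_of_innermost hG h6 h1) h4, ?_⟩
    rw [List.map_cons, List.map_cons, h5, (lift_of_innermost hG h1 h6).1]

/-- What unrestricted derivations produce from a version of a term, innermost-outermost derivations
of `G` produce from the term. If the term is a redex with converging arguments, its arguments are
first brought to normal form; by confluence, nothing is lost. The first reduction that then changes
the redex contracts it, which leaves fewer reductions. -/
theorem exists_innermost_ge (hG : G.IsHORS) (n : ℕ) {t : Term} {τ : Ty} (ht : G.Typed t τ)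
    (hτ : τ = .o ∨ ∃ a, t.head = .terminal a) {v q : Term} (hv : v ∈ G.lift t)
    (hq : G.correct.ParN n v q) :
    ∃ t', ReflTransGen G.InnermostStep t t' ∧ ∀ ts ts', List.Forall₂ (· ≤ ·) ts ts' →
      q.botTransformAux ts ≤ t'.botTransformAux ts' := by
  induction n using Nat.strong_induction_on generalizing t τ v q with
  | _ n ihn =>
    -- The case of a redex, to which both the atoms and the applications lead.
    have hredex : ∀ F ss e, G.Contracts F ss e → G.Typed ((Term.nonterminal F).apps ss) .o →
        ∀ v ∈ G.lift ((Term.nonterminal F).apps ss), ∀ q, G.correct.ParN n v q →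
        ∃ t', ReflTransGen G.InnermostStep ((Term.nonterminal F).apps ss) t' ∧
          ∀ ts ts', List.Forall₂ (· ≤ ·) ts ts' →
            q.botTransformAux ts ≤ t'.botTransformAux ts' := by
      intro F ss e hc ht v hv q hq
      obtain ⟨τ, he, -, hs, hb⟩ := hc.hasType hG ht
      rw [lift_redex hG he hs, List.mem_singleton] at hv
      subst hv
      by_cases hconv : (ss.map G.code).all conv
      · obtain ⟨ns, hred, hnorm, hns, hcode⟩ := exists_normal_list hG hs hconv
        have hred' : ReflTransGen G.InnermostStep ((Term.nonterminal F).apps ss)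
            ((Term.nonterminal F).apps ns) := innermost_apps .refl hred
        have hsim := (lift_of_innermost hG ht hred').2
        rw [lift_redex hG he hs, lift_redex hG he hns] at hsim
        obtain ⟨r, hqr, hr⟩ := hq.strip
          (ReflTransGen.mono (fun _ _ h => h.par) _ _ (List.forall₂_cons.1 hsim).1)
        have hnorm' := normal_flatMap_lift hG hns hnorm
        rcases ParN.redex_inv (correct_contracts hG he hns) hnorm' hr with rfl | ⟨m, hm, hm'⟩
        · refine ⟨_, .refl, fun ts ts' h => (botTransformAux_le_of_par hqr h).trans ?_⟩
          rw [botTransformAux_of_head (Term.head_apps _ _)]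
          exact Tree.bot_le _
        · have hlift := lift_subst hG he hns (by rw [hcode]; exact hconv)
          obtain ⟨t', h1, h2⟩ := ihn m hm (hb.subst hns) (Or.inl rfl)
            (by rw [hlift]; exact List.mem_singleton_self _) hm'
          have hstep : G.InnermostStep ((Term.nonterminal F).apps ns) (e.subst ns) :=
            .redex (hc.congr (by rw [hns.length_eq, hs.length_eq])) hnorm
          refine ⟨t', hred'.trans (.head hstep h1), fun ts ts' h => ?_⟩
          exact (botTransformAux_le_of_par hqr h).trans
            (h2 ts' ts' (List.forall₂_same.2 fun _ _ => le_rfl))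
      · -- An argument diverges, and the version of the redex can only be contracted to `Ω`.
        have hcon := correct_contracts hG he hs
        have hd : decode τ.args (encode τ.args (ss.map G.code)) = ss.map G.code :=
          decode_encode ((forall₂_good_code hG hs).imp fun _ _ h => h.lt)
        rw [versionBody, hd, if_neg hconv] at hcon
        refine ⟨_, .refl, fun ts ts' _ => ?_⟩
        rw [ParN.bot_of_void hcon hq]
        exact Tree.bot_le _
    induction t generalizing τ v q with
    | terminal a =>
      have := ParN.eq_of_normal hq (normal_lift hG ht (normal_terminal a) v hv)
      subst this
      refine ⟨_, .refl, fun ts ts' h => ?_⟩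
      rw [botTransformAux_lift hG ht _ hv]
      exact botTransformAux_mono _ h
    | nonterminal F =>
      obtain rfl : τ = .o := hτ.resolve_right fun ⟨a, ha⟩ => by cases ha
      obtain ⟨ts, e, hc, hF⟩ := exists_redex (F := F) rfl ht
      rw [hF] at ht hv ⊢
      exact hredex _ _ _ hc ht _ hv _ hq
    | var i => cases ht with | var h => simp at h
    | app t s iht ihs =>
      have ht0 := ht
      cases ht with
      | @app _ _ σ _ ht hs =>
        rcases ht.head_eq with ⟨a, ha⟩ | ⟨F, hF⟩
        · obtain rfl := ht.dom_eq_o_of_head ha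
          obtain ⟨u, hu, rfl⟩ := Typed.mem_lift_app hG ht hs hv
          have hs1 := Typed.lift_eq_singleton hs
          rw [hs1] at hq
          obtain ⟨u', s', rfl, h1, h2⟩ := ParN.app_inv (head_lift hG ht ha u hu) hq
          obtain ⟨t1, h3, h4⟩ := iht ht (Or.inr ⟨a, ha⟩) hu h1
          obtain ⟨s1, h5, h6⟩ := ihs hs (Or.inl rfl)
            (by rw [hs1]; exact List.mem_singleton_self _) h2
          exact ⟨_, innermost_app h3 h5, fun ts ts' h => h4 _ _ (.cons (h6 _ _ .nil) h)⟩
        · obtain rfl : τ = .o := hτ.resolve_right fun ⟨a, ha⟩ => by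
            rw [show Term.head (.app t s) = t.head from rfl, hF] at ha; cases ha
          obtain ⟨ts, e, hc, hF⟩ := exists_redex (t := .app t s) hF ht0
          rw [hF] at ht0 hv ⊢
          exact hredex _ _ _ hc ht0 _ hv _ hq

/-! ### Value trees of the self-correcting scheme -/

theorem typed_start (hG : G.IsHORS) : G.Typed (.nonterminal G.start) .o := .nonterminal hG.start

theorem lift_start (hG : G.IsHORS) :
    G.lift (.nonterminal G.start) = [.nonterminal G.correct.start] := by
  simp [lift, Term.versions, hG.start, correct]

theorem innermostAcc_subset_acc (G : Scheme) : G.InnermostAcc ⊆ G.Acc := fun _ h =>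
  ReflTransGen.mono (r := G.InnermostStep) (fun _ _ h => h.step) _ _ h

theorem botTransform_innermostAcc_subset (hG : G.IsHORS) :
    Term.botTransform '' G.InnermostAcc ⊆ Term.botTransform '' G.correct.InnermostAcc := by
  rintro _ ⟨t, ht, rfl⟩
  have h := (lift_of_innermost hG (typed_start hG) ht).2
  have ht' := hasType_of_innermost hG ht (typed_start hG)
  rw [lift_start hG, Typed.lift_eq_singleton ht'] at h
  refine ⟨_, (List.forall₂_cons.1 h).1, botTransformAux_lift hG ht' _ ?_ _⟩
  rw [Typed.lift_eq_singleton ht']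
  exact List.mem_singleton_self _

theorem exists_innermostAcc_ge (hG : G.IsHORS) {q : Term} (hq : q ∈ G.correct.Acc) :
    ∃ t ∈ G.InnermostAcc, q.botTransform ≤ t.botTransform := by
  obtain ⟨n, hn⟩ := exists_parN
    (ReflTransGen.mono (r := G.correct.Step) (fun _ _ h => h.par) _ _ hq)
  obtain ⟨t, h1, h2⟩ := exists_innermost_ge hG n (typed_start hG) (Or.inl rfl)
    (by rw [lift_start hG]; exact List.mem_singleton_self _) hn
  exact ⟨t, h1, h2 [] [] .nil⟩

/-- The unrestricted and the innermost-outermost value tree of the self-correcting scheme are the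
innermost-outermost value tree of `G`. -/
theorem correct_isValueTree (hG : G.IsHORS) {T : Tree} (hT : G.IsInnermostValueTree T) :
    G.correct.IsValueTree T ∧ G.correct.IsInnermostValueTree T := by
  have h1 := Set.image_mono (f := Term.botTransform) (innermostAcc_subset_acc G.correct)
  have h2 := botTransform_innermostAcc_subset hG
  have hub : T ∈ upperBounds (Term.botTransform '' G.correct.Acc) := by
    rintro _ ⟨q, hq, rfl⟩
    obtain ⟨t, ht, hle⟩ := exists_innermostAcc_ge hG hq
    exact hle.trans (hT.1 ⟨t, ht, rfl⟩)
  exact ⟨⟨hub, fun U hU => hT.2 fun A hA => hU (h1 (h2 hA))⟩,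
    ⟨fun A hA => hub (h1 hA), fun U hU => hT.2 fun A hA => hU (h2 hA)⟩⟩

end Scheme

end HORS

namespace HORS

open Primrec

/-! ### Recursion on types and terms is primitive recursive -/

theorem Ty.primrec_toNat : Primrec Ty.toNat := Primrec.of_equiv (e := Ty.equivNat)

theorem Ty.primrec_ofNat : Primrec Ty.ofNat := Primrec.of_equiv_symm (e := Ty.equivNat)

theorem Term.primrec_toNat : Primrec Term.toNat := Primrec.of_equiv (e := Term.equivNat)

theorem Term.primrec_ofNat : Primrec Term.ofNat := Primrec.of_equiv_symm (e := Term.equivNat)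

section

variable {α σ : Type*} [Primcodable α] [Primcodable σ]

/-- Structural recursion on types, with access to the components, is primitive recursive. It becomes
a course-of-values recursion on the Gödel numbers. -/
theorem Ty.primrec_rec {f : α → Ty → σ} {g₀ : α → σ} {g₁ : α → Ty × Ty × σ × σ → σ}
    (hg₀ : Primrec g₀) (hg₁ : Primrec₂ g₁) (h₀ : ∀ a, f a .o = g₀ a)
    (h₁ : ∀ a τ τ', f a (.arr τ τ') = g₁ a (τ, τ', f a τ, f a τ')) : Primrec₂ f := by
  let g : α → List σ → Option σ := fun a l =>
    Nat.casesOn l.length (some (g₀ a)) fun m =>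
      l[m.unpair.1]?.bind fun r => l[m.unpair.2]?.map fun r' =>
        g₁ a (Ty.ofNat m.unpair.1, Ty.ofNat m.unpair.2, r, r')
  have hg : Primrec₂ g := by
    refine Primrec.nat_casesOn (list_length.comp snd) (option_some.comp (hg₀.comp fst)) ?_
    have hl : Primrec fun p : ((α × List σ) × ℕ) => p.1.2 := snd.comp fst
    have hm1 : Primrec fun p : ((α × List σ) × ℕ) => p.2.unpair.1 := fst.comp (unpair.comp snd)
    have hm2 : Primrec fun p : ((α × List σ) × ℕ) => p.2.unpair.2 := snd.comp (unpair.comp snd)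
    refine option_bind (list_getElem?.comp hl hm1) ?_
    refine option_map (list_getElem?.comp (hl.comp fst) (hm2.comp fst)) ?_
    exact hg₁.comp (fst.comp (fst.comp (fst.comp fst)))
      ((Ty.primrec_ofNat.comp (hm1.comp (fst.comp fst))).pair
        ((Ty.primrec_ofNat.comp (hm2.comp (fst.comp fst))).pair
          ((snd.comp fst).pair snd)))
  have key : Primrec₂ fun a n => f a (Ty.ofNat n) := by
    refine nat_strong_rec _ hg fun a n => ?_
    cases n with
    | zero => simp [g, Ty.ofNat, h₀]
    | succ n =>
      have h1 := Nat.lt_succ_of_le (Nat.unpair_left_le n)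
      have h2 := Nat.lt_succ_of_le (Nat.unpair_right_le n)
      rw [Ty.ofNat, h₁]
      simp [g, h1, h2]
  refine (key.comp fst (Ty.primrec_toNat.comp snd)).of_eq fun p => ?_
  rw [Ty.ofNat_toNat]

/-- Structural recursion on terms, with access to the components, is primitive recursive. -/
theorem Term.primrec_rec {f : α → Term → σ} {g₀ : α → Terminal → σ} {g₁ g₂ : α → ℕ → σ}
    {g₃ : α → Term × Term × σ × σ → σ} (hg₀ : Primrec₂ g₀) (hg₁ : Primrec₂ g₁) (hg₂ : Primrec₂ g₂)
    (hg₃ : Primrec₂ g₃) (h₀ : ∀ a x, f a (.terminal x) = g₀ a x)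
    (h₁ : ∀ a F, f a (.nonterminal F) = g₁ a F) (h₂ : ∀ a i, f a (.var i) = g₂ a i)
    (h₃ : ∀ a t s, f a (.app t s) = g₃ a (t, s, f a t, f a s)) : Primrec₂ f := by
  let g : α → List σ → Option σ := fun a l =>
    if l.length % 4 = 0 then
      some (g₀ a ⟨(l.length / 4).unpair.1, (l.length / 4).unpair.2⟩)
    else if l.length % 4 = 1 then some (g₁ a (l.length / 4))
    else if l.length % 4 = 2 then some (g₂ a (l.length / 4))
    else l[(l.length / 4).unpair.1]?.bind fun r => l[(l.length / 4).unpair.2]?.map fun r' =>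
        g₃ a (Term.ofNat (l.length / 4).unpair.1, Term.ofNat (l.length / 4).unpair.2, r, r')
  have hg : Primrec₂ g := by
    have hn : Primrec fun p : α × List σ => p.2.length := list_length.comp snd
    have hm : Primrec fun p : α × List σ => p.2.length / 4 := nat_div.comp hn (const 4)
    have hr : Primrec fun p : α × List σ => p.2.length % 4 := nat_mod.comp hn (const 4)
    have hm1 : Primrec fun p : α × List σ => (p.2.length / 4).unpair.1 := fst.comp (unpair.comp hm)
    have hm2 : Primrec fun p : α × List σ => (p.2.length / 4).unpair.2 := snd.comp (unpair.comp hm)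
    have hter : Primrec fun p : ℕ × ℕ => (⟨p.1, p.2⟩ : Terminal) :=
      Primrec.of_equiv_symm (e := Terminal.equivProd)
    refine Primrec.ite (Primrec.eq.comp hr (const 0))
      (option_some.comp (hg₀.comp fst (hter.comp (hm1.pair hm2)))) ?_
    refine Primrec.ite (Primrec.eq.comp hr (const 1)) (option_some.comp (hg₁.comp fst hm)) ?_
    refine Primrec.ite (Primrec.eq.comp hr (const 2)) (option_some.comp (hg₂.comp fst hm)) ?_
    refine option_bind (list_getElem?.comp snd hm1) ?_
    refine option_map (list_getElem?.comp (snd.comp fst) (hm2.comp fst)) ?_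
    exact hg₃.comp (fst.comp (fst.comp fst))
      ((Term.primrec_ofNat.comp (hm1.comp (fst.comp fst))).pair
        ((Term.primrec_ofNat.comp (hm2.comp (fst.comp fst))).pair
          ((snd.comp fst).pair snd)))
  have key : Primrec₂ fun a n => f a (Term.ofNat n) := by
    refine nat_strong_rec _ hg fun a n => ?_
    have h1 := Nat.unpair_left_le (n / 4)
    have h2 := Nat.unpair_right_le (n / 4)
    rw [Term.ofNat]
    simp only [g, List.length_map, List.length_range]
    split_ifs with c0 c1 c2
    · rw [h₀]
    · rw [h₁]
    · rw [h₂]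
    · have h1 : (n / 4).unpair.1 < n := by omega
      have h2 : (n / 4).unpair.2 < n := by omega
      rw [h₃]
      simp [h1, h2]
  refine (key.comp fst (Term.primrec_toNat.comp snd)).of_eq fun p => ?_
  rw [Term.ofNat_toNat]

end

/-! ### The construction is primitive recursive -/

theorem primrec_pow : Primrec₂ fun a b : ℕ => a ^ b := by
  have : Primrec₂ fun a b : ℕ => (Nat.rec 1 (fun _ r => r * a) b : ℕ) :=
    Primrec.nat_rec (const 1) (nat_mul.comp (snd.comp snd) fst).to₂
  refine this.of_eq fun a b => ?_
  induction b with
  | zero => rfl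
  | succ b ih => rw [pow_succ, ← ih]

theorem primrec_testBit : Primrec₂ Nat.testBit := by
  have : Primrec₂ fun x i : ℕ => decide (x / 2 ^ i % 2 = 1) :=
    PrimrecPred.decide (Primrec.eq.comp (nat_mod.comp
      (nat_div.comp fst (primrec_pow.comp (const 2) snd)) (const 2)) (const 1))
  exact this.of_eq fun x i => (Nat.testBit_eq_decide_div_mod_eq).symm

theorem primrec_replicate {α : Type*} [Primcodable α] :
    Primrec₂ (List.replicate : ℕ → α → List α) :=
  (list_map (list_range.comp fst) (snd.comp fst).to₂).of_eq fun p => by simp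

namespace Ty

theorem primrec_arr : Primrec₂ Ty.arr := by
  refine (primrec_ofNat.comp (succ.comp (Primrec₂.natPair.comp (primrec_toNat.comp fst)
    (primrec_toNat.comp snd)))).of_eq fun p => ?_
  exact ofNat_toNat (.arr p.1 p.2)

theorem primrec_dom : Primrec Ty.dom :=
  (primrec_rec (α := Unit) (f := fun _ => Ty.dom) (const .o) (fst.comp snd).to₂
    (fun _ => rfl) fun _ _ _ => rfl).comp (const ()) .id

theorem primrec_cod : Primrec Ty.cod :=
  (primrec_rec (α := Unit) (f := fun _ => Ty.cod) (const .o) (fst.comp (snd.comp snd)).to₂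
    (fun _ => rfl) fun _ _ _ => rfl).comp (const ()) .id

theorem primrec_args : Primrec Ty.args :=
  (primrec_rec (α := Unit) (f := fun _ => Ty.args) (const [])
    (list_cons.comp (fst.comp snd) (snd.comp (snd.comp (snd.comp snd)))).to₂
    (fun _ => rfl) fun _ _ _ => rfl).comp (const ()) .id

theorem primrec_size : Primrec Ty.size := by
  have h : Primrec fun p : Unit × Ty × Ty × (ℕ × ℕ) × (ℕ × ℕ) => p.2.2.2.1.1 * p.2.2.2.2.2 :=
    nat_mul.comp (fst.comp (fst.comp (snd.comp (snd.comp snd))))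
      (snd.comp (snd.comp (snd.comp (snd.comp snd))))
  exact (primrec_rec (α := Unit) (f := fun _ => Ty.size) (const (2, 1))
    ((primrec_pow.comp (const 2) (nat_add.comp (const 1) h)).pair h).to₂
    (fun _ => rfl) fun _ _ _ => rfl).comp (const ()) .id

theorem primrec_card : Primrec Ty.card := fst.comp primrec_size

theorem primrec_idx : Primrec Ty.idx := snd.comp primrec_size

theorem primrec_arrs : Primrec₂ Ty.arrs :=
  list_foldr fst snd (primrec_arr.comp (fst.comp snd) (snd.comp snd)).to₂

theorem primrec_tr : Primrec Ty.tr :=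
  (primrec_rec (α := Unit) (f := fun _ => Ty.tr) (const .o)
    (primrec_arrs.comp
      (primrec_replicate.comp (primrec_idx.comp (fst.comp snd))
        (fst.comp (snd.comp (snd.comp snd))))
      (snd.comp (snd.comp (snd.comp snd)))).to₂
    (fun _ => rfl) fun _ _ _ => rfl).comp (const ()) .id

theorem primrec_ofArity : Primrec Ty.ofArity := by
  refine (Primrec.nat_rec₁ (f := fun _ τ => .arr .o τ) Ty.o
    (primrec_arr.comp (const .o) snd).to₂).of_eq fun n => ?_
  induction n with
  | zero => rfl
  | succ n ih => rw [ofArity, ← ih]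

end Ty

theorem Terminal.primrec_type : Primrec Terminal.type :=
  Ty.primrec_ofArity.comp (snd.comp (Primrec.of_equiv (e := Terminal.equivProd)))

namespace Term

theorem primrec_app : Primrec₂ Term.app := by
  refine (primrec_ofNat.comp (nat_add.comp (nat_mul.comp (const 4) (Primrec₂.natPair.comp
    (primrec_toNat.comp fst) (primrec_toNat.comp snd))) (const 3))).of_eq fun p => ?_
  exact ofNat_toNat (.app p.1 p.2)

theorem primrec_nonterminal : Primrec Term.nonterminal := by
  refine (primrec_ofNat.comp (nat_add.comp (nat_mul.comp (const 4) .id) (const 1))).of_eq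
    fun F => ?_
  exact ofNat_toNat (.nonterminal F)

theorem primrec_var : Primrec Term.var := by
  refine (primrec_ofNat.comp (nat_add.comp (nat_mul.comp (const 4) .id) (const 2))).of_eq
    fun F => ?_
  exact ofNat_toNat (.var F)

theorem primrec_terminal : Primrec Term.terminal := by
  have h : Primrec Terminal.equivProd := Primrec.of_equiv (e := Terminal.equivProd)
  refine (primrec_ofNat.comp (nat_mul.comp (const 4) (Primrec₂.natPair.comp
    (fst.comp h) (snd.comp h)))).of_eq fun a => ?_
  exact ofNat_toNat (.terminal a)

theorem primrec_apps : Primrec₂ Term.apps :=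
  list_foldl snd fst (primrec_app.comp (fst.comp snd) (snd.comp snd)).to₂

end Term

section

variable {α : Type*} [Primcodable α]

theorem primrec_ofBits {r : α → ℕ → Bool} {n : α → ℕ} (hr : Primrec₂ r) (hn : Primrec n) :
    Primrec fun a => ofBits (r a) (n a) := by
  have h : Primrec₂ fun (a : α) (n : ℕ) =>
      (Nat.rec 0 (fun n s => 2 ^ n * (r a n).toNat + s) n : ℕ) :=
    Primrec.nat_rec (const 0) (nat_add.comp (nat_mul.comp
      (primrec_pow.comp (const 2) (fst.comp snd))
      ((dom_bool Bool.toNat).comp (hr.comp fst (fst.comp snd)))) (snd.comp snd)).to₂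
  refine (h.comp .id hn).of_eq fun a => ?_
  change (Nat.rec 0 (fun n s => 2 ^ n * (r a n).toNat + s) (n a) : ℕ) = _
  generalize n a = n
  induction n with
  | zero => rfl
  | succ n ih => rw [ofBits, ← ih]

theorem primrec_conv : Primrec conv := primrec_testBit.comp .id (const 0)

theorem primrec_mk {τ : α → Ty} {c : α → Bool} {r : α → ℕ → Bool} (hτ : Primrec τ)
    (hc : Primrec c) (hr : Primrec₂ r) : Primrec fun a => mk (τ a) (c a) (r a) := by
  have h : Primrec₂ fun a σ => mk σ (c a) (r a) := by
    refine Ty.primrec_rec (g₀ := fun a => (c a && r a 0).toNat)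
      (g₁ := fun a p => ofBits (fun i => c a && (i == 0 || r a (i - 1)))
        (1 + (Ty.arr p.1 p.2.1).idx))
      ((dom_bool Bool.toNat).comp (Primrec.and.comp hc (hr.comp .id (const 0)))) ?_
      (fun _ => rfl) fun _ _ _ => rfl
    refine primrec_ofBits (α := α × Ty × Ty × ℕ × ℕ) (r := fun p i =>
      c p.1 && (i == 0 || r p.1 (i - 1))) ?_ ?_
    · exact Primrec.and.comp (hc.comp (fst.comp fst)) (Primrec.or.comp
        (Primrec.beq.comp snd (const 0))
        (hr.comp (fst.comp fst) (nat_sub.comp snd (const 1))))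
    · exact nat_add.comp (const 1) (Ty.primrec_idx.comp
        (Ty.primrec_arr.comp (fst.comp snd) (fst.comp (snd.comp snd))))
  exact h.comp .id hτ

theorem primrec_appCode {a b : α → Ty} {f x : α → ℕ} (ha : Primrec a) (hb : Primrec b)
    (hf : Primrec f) (hx : Primrec x) : Primrec fun p => appCode (a p) (b p) (f p) (x p) :=
  primrec_mk (r := fun p w => (f p).testBit (1 + (x p + (a p).card * w))) hb
    (Primrec.and.comp (primrec_conv.comp hf) (primrec_conv.comp hx))
    (primrec_testBit.comp (hf.comp fst) (nat_add.comp (const 1) (nat_add.comp (hx.comp fst)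
      (nat_mul.comp (Ty.primrec_card.comp (ha.comp fst)) snd))))

theorem primrec_decode : Primrec₂ decode := by
  have h : Primrec₂ fun (as : List Ty) (w : ℕ) => (as.foldl (fun (s : List ℕ × ℕ) a =>
      (s.1 ++ [s.2 % a.card], s.2 / a.card)) ([], w)).1 := by
    refine fst.comp (list_foldl (h := fun (_ : List Ty × ℕ) (q : (List ℕ × ℕ) × Ty) =>
      (q.1.1 ++ [q.1.2 % q.2.card], q.1.2 / q.2.card)) fst ((const []).pair snd) ?_)
    have hc : Primrec fun p : (List Ty × ℕ) × (List ℕ × ℕ) × Ty => p.2.2.card :=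
      Ty.primrec_card.comp (snd.comp snd)
    have hw : Primrec fun p : (List Ty × ℕ) × (List ℕ × ℕ) × Ty => p.2.1.2 :=
      snd.comp (fst.comp snd)
    exact (list_concat.comp (fst.comp (fst.comp snd)) (nat_mod.comp hw hc)).pair
      (nat_div.comp hw hc)
  have key : ∀ (as : List Ty) (w : ℕ) (l : List ℕ), (as.foldl (fun (s : List ℕ × ℕ) a =>
      (s.1 ++ [s.2 % a.card], s.2 / a.card)) (l, w)).1 = l ++ decode as w := by
    intro as
    induction as with
    | nil => simp [decode]
    | cons a as ih => intro w l; simp [ih, decode]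
  exact h.of_eq fun as w => by simpa using key as w []

theorem primrec_cst {τ : α → Ty} {c : α → Bool} {h : α → List ℕ → Bool} (hτ : Primrec τ)
    (hc : Primrec c) (hh : Primrec₂ h) : Primrec fun a => cst (τ a) (c a) (h a) :=
  primrec_mk hτ hc (hh.comp fst (primrec_decode.comp (Ty.primrec_args.comp (hτ.comp fst)) snd))

theorem primrec_all_conv : Primrec fun l : List ℕ => l.all conv := by
  refine (list_foldr (h := fun _ (q : ℕ × Bool) => conv q.1 && q.2) .id (const true)
    (Primrec.and.comp (primrec_conv.comp (fst.comp snd)) (snd.comp snd))).of_eq fun l => ?_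
  induction l with
  | nil => rfl
  | cons a l ih => rw [List.all_cons, ← ih]; rfl

theorem primrec_sum : Primrec fun l : List ℕ => l.sum :=
  list_foldr (h := fun _ (q : ℕ × ℕ) => q.1 + q.2) .id (const 0)
    (nat_add.comp (fst.comp snd) (snd.comp snd))

theorem primrec_offset : Primrec₂ offset := by
  have h : Primrec₂ fun (N : List Ty) (n : ℕ) =>
      (Nat.rec 0 (fun i s => s + (N.getD i .o).idx) n : ℕ) :=
    Primrec.nat_rec (const 0) (nat_add.comp (snd.comp snd)
      (Ty.primrec_idx.comp ((list_getD Ty.o).comp fst (fst.comp snd)))).to₂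
  refine h.of_eq fun N n => ?_
  induction n with
  | zero => rfl
  | succ n ih => rw [offset, ← ih]

end

namespace Term

theorem primrec_inferTy : Primrec₂ fun (p : List Ty × List Ty) (t : Term) => t.inferTy p.1 p.2 :=
  primrec_rec (g₀ := fun _ a => a.type) (g₁ := fun p F => p.1.getD F .o)
    (g₂ := fun p i => p.2.getD i .o) (g₃ := fun _ q => q.2.2.1.cod)
    (Terminal.primrec_type.comp snd) ((list_getD _).comp (fst.comp fst) snd)
    ((list_getD _).comp (snd.comp fst) snd)
    (Ty.primrec_cod.comp (fst.comp (snd.comp (snd.comp snd))))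
    (fun _ _ => rfl) (fun _ _ => rfl) (fun _ _ => rfl) fun _ _ _ => rfl

/-- The data that the code and the versions of a term depend on: types and codes of the
non-terminals, types and codes of the variables. -/
abbrev Ctx : Type := (List Ty × List ℕ) × List Ty × List ℕ

theorem primrec_inferTy_ctx : Primrec₂ fun (p : Ctx) (t : Term) => t.inferTy p.1.1 p.2.1 :=
  primrec_inferTy.comp ((fst.comp (fst.comp fst)).pair (fst.comp (snd.comp fst))) snd

theorem primrec_code :
    Primrec₂ fun (p : Ctx) (t : Term) => t.code p.1.1 p.1.2 p.2.1 p.2.2 := by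
  refine primrec_rec (α := Ctx) (g₀ := fun _ a => cst a.type true fun _ => true)
    (g₁ := fun p F => p.1.2.getD F 0) (g₂ := fun p i => p.2.2.getD i 0)
    (g₃ := fun p q => appCode (q.1.inferTy p.1.1 p.2.1).dom (q.1.inferTy p.1.1 p.2.1).cod
      q.2.2.1 q.2.2.2) ?_ ?_ ?_ ?_
    (fun _ _ => rfl) (fun _ _ => rfl) (fun _ _ => rfl) fun _ _ _ => rfl
  · exact primrec_cst (α := Ctx × Terminal) (h := fun _ _ => true)
      (Terminal.primrec_type.comp snd) (const true) (const true)
  · exact (list_getD 0).comp (snd.comp (fst.comp fst)) snd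
  · exact (list_getD 0).comp (snd.comp (snd.comp fst)) snd
  · have h : Primrec fun x : Ctx × Term × Term × ℕ × ℕ => x.2.1.inferTy x.1.1.1 x.1.2.1 :=
      primrec_inferTy_ctx.comp fst (fst.comp snd)
    exact primrec_appCode (Ty.primrec_dom.comp h) (Ty.primrec_cod.comp h)
      (fst.comp (snd.comp (snd.comp snd))) (snd.comp (snd.comp (snd.comp snd)))

theorem primrec_versions :
    Primrec₂ fun (p : Ctx) (t : Term) => t.versions p.1.1 p.1.2 p.2.1 p.2.2 := by
  refine primrec_rec (α := Ctx) (g₀ := fun _ a => List.replicate a.type.idx (.terminal a))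
    (g₁ := fun p F => (List.range (p.1.1.getD F .o).idx).map fun w =>
      .nonterminal (offset p.1.1 F + w))
    (g₂ := fun p i => (List.range (p.2.1.getD i .o).idx).map fun w => .var (offset p.2.1 i + w))
    (g₃ := fun p q => (List.range (q.1.inferTy p.1.1 p.2.1).cod.idx).map fun w =>
      (q.2.2.1.getD (q.2.1.code p.1.1 p.1.2 p.2.1 p.2.2 + (q.1.inferTy p.1.1 p.2.1).dom.card * w)
        (.nonterminal 0)).apps q.2.2.2) ?_ ?_ ?_ ?_
    (fun _ _ => rfl) (fun _ _ => rfl) (fun _ _ => rfl) fun _ _ _ => rfl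
  · exact primrec_replicate.comp (Ty.primrec_idx.comp (Terminal.primrec_type.comp snd))
      (primrec_terminal.comp snd)
  · have hN : Primrec fun x : Ctx × ℕ => x.1.1.1 := fst.comp (fst.comp fst)
    exact list_map (list_range.comp (Ty.primrec_idx.comp ((list_getD Ty.o).comp hN snd)))
      (primrec_nonterminal.comp (nat_add.comp
        (primrec_offset.comp (hN.comp fst) (snd.comp fst)) snd))
  · have hX : Primrec fun x : Ctx × ℕ => x.1.2.1 := fst.comp (snd.comp fst)
    exact list_map (list_range.comp (Ty.primrec_idx.comp ((list_getD Ty.o).comp hX snd)))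
      (primrec_var.comp (nat_add.comp
        (primrec_offset.comp (hX.comp fst) (snd.comp fst)) snd))
  · have h : Primrec fun x : Ctx × Term × Term × List Term × List Term =>
        x.2.1.inferTy x.1.1.1 x.1.2.1 := primrec_inferTy_ctx.comp fst (fst.comp snd)
    have hcode : Primrec fun x : Ctx × Term × Term × List Term × List Term =>
        x.2.2.1.code x.1.1.1 x.1.1.2 x.1.2.1 x.1.2.2 :=
      primrec_code.comp fst (fst.comp (snd.comp snd))
    refine list_map (list_range.comp (Ty.primrec_idx.comp (Ty.primrec_cod.comp h))) ?_
    refine primrec_apps.comp ((list_getD (Term.nonterminal 0)).comp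
      (fst.comp (snd.comp (snd.comp (snd.comp fst)))) ?_)
      (snd.comp (snd.comp (snd.comp (snd.comp fst))))
    exact nat_add.comp (hcode.comp fst)
      (nat_mul.comp (Ty.primrec_card.comp (Ty.primrec_dom.comp (h.comp fst))) snd)

end Term

namespace Scheme

theorem primrec_terminals : Primrec Scheme.terminals :=
  fst.comp (Primrec.of_equiv (e := Scheme.equivProd))

theorem primrec_rules : Primrec Scheme.rules :=
  fst.comp (snd.comp (Primrec.of_equiv (e := Scheme.equivProd)))

theorem primrec_start : Primrec Scheme.start :=
  snd.comp (snd.comp (Primrec.of_equiv (e := Scheme.equivProd)))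

theorem primrec_types : Primrec Scheme.types := list_map primrec_rules (fst.comp snd)

theorem primrec_nextCodes : Primrec₂ nextCodes := by
  refine list_map (f := fun q : Scheme × List ℕ => q.1.rules)
    (g := fun q (p : Ty × Term) =>
      cst p.1 true fun ds => conv (p.2.code q.1.types q.2 p.1.args ds))
    (primrec_rules.comp fst) ?_
  refine primrec_cst (α := (Scheme × List ℕ) × Ty × Term) (τ := fun x => x.2.1)
    (h := fun x ds => conv (x.2.2.code x.1.1.types x.1.2 x.2.1.args ds))
    (fst.comp snd) (const true) (primrec_conv.comp ?_)
  exact Term.primrec_code.comp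
    (((primrec_types.comp (fst.comp (fst.comp fst))).pair (snd.comp (fst.comp fst))).pair
      ((Ty.primrec_args.comp (fst.comp (snd.comp fst))).pair snd))
    (snd.comp (snd.comp fst))

theorem primrec_codes : Primrec codes := by
  have h : Primrec₂ fun (G : Scheme) (n : ℕ) =>
      (Nat.rec (G.rules.map fun _ => 0) (fun _ M => G.nextCodes M) n : List ℕ) :=
    Primrec.nat_rec (list_map primrec_rules (const 0).to₂)
      (primrec_nextCodes.comp fst (snd.comp snd)).to₂
  have h' : Primrec₂ codesAt := h.of_eq fun G n => by
    induction n with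
    | zero => rfl
    | succ n ih => rw [codesAt, ← ih]
  have hr : Primrec rounds := primrec_pow.comp
    (primrec_sum.comp (list_map primrec_types (Ty.primrec_card.comp snd)))
    (list_length.comp primrec_types)
  exact h'.comp .id (succ.comp hr)

theorem primrec_voidIndex : Primrec voidIndex :=
  primrec_offset.comp primrec_types (list_length.comp primrec_types)

theorem primrec_versionBody :
    Primrec fun x : (Scheme × Ty × Term) × ℕ => x.1.1.versionBody x.1.2 x.2 := by
  have hargs : Primrec fun x : (Scheme × Ty × Term) × ℕ => x.1.2.1.args :=
    Ty.primrec_args.comp (fst.comp (snd.comp fst))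
  have hds : Primrec fun x : (Scheme × Ty × Term) × ℕ => decode x.1.2.1.args x.2 :=
    primrec_decode.comp hargs snd
  have hvoid : Primrec fun x : (Scheme × Ty × Term) × ℕ => Term.nonterminal x.1.1.voidIndex :=
    Term.primrec_nonterminal.comp (primrec_voidIndex.comp (fst.comp fst))
  have hG : Primrec fun x : (Scheme × Ty × Term) × ℕ => x.1.1 := fst.comp fst
  have hver : Primrec fun x : (Scheme × Ty × Term) × ℕ => x.1.2.2.versions x.1.1.types x.1.1.codes
      x.1.2.1.args (decode x.1.2.1.args x.2) :=
    Term.primrec_versions.comp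
      (((primrec_types.comp hG).pair (primrec_codes.comp hG)).pair (hargs.pair hds))
      (snd.comp (snd.comp fst))
  refine Primrec.ite (Primrec.eq.comp (primrec_all_conv.comp hds) (const true)) ?_ hvoid
  refine (option_getD.comp (list_getElem?.comp hver (const 0)) hvoid).of_eq fun x => ?_
  rw [List.getD_eq_getElem?_getD]

/-- The construction of the self-correcting scheme is primitive recursive. -/
theorem primrec_correct : Primrec correct := by
  have h : Primrec fun G : Scheme => (G.rules.flatMap fun p =>
      (List.range p.1.idx).map fun w => (p.1.tr, G.versionBody p w)) := by
    refine list_flatMap primrec_rules ?_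
    refine list_map (list_range.comp (Ty.primrec_idx.comp (fst.comp snd))) ?_
    exact (Ty.primrec_tr.comp (fst.comp (snd.comp fst))).pair primrec_versionBody
  have hlast : Primrec fun G : Scheme => (Ty.o, Term.nonterminal G.voidIndex) :=
    (const Ty.o).pair (Term.primrec_nonterminal.comp primrec_voidIndex)
  refine (Primrec.of_equiv_iff Scheme.equivProd).1 ?_
  exact primrec_terminals.pair ((list_concat.comp h hlast).pair
    (primrec_offset.comp primrec_types primrec_start))

end Scheme

end HORS

theorem mainTheorem2 :
    ∃ selfCorrecting : HORS.Scheme → HORS.Scheme, Computable selfCorrecting ∧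
      ∀ G : HORS.Scheme, G.IsHORS →
        (selfCorrecting G).IsHORS ∧
        (selfCorrecting G).terminals = G.terminals ∧
        (selfCorrecting G).order = G.order ∧
        ∃ T : HORS.Tree,
          (selfCorrecting G).IsValueTree T ∧
          (selfCorrecting G).IsInnermostValueTree T ∧
          G.IsInnermostValueTree T := by
  refine ⟨HORS.Scheme.correct, HORS.Scheme.primrec_correct.to_comp, fun G hG => ?_⟩
  obtain ⟨T, hT⟩ := G.exists_innermostValueTree
  obtain ⟨h1, h2⟩ := HORS.Scheme.correct_isValueTree hG hT
  exact ⟨HORS.Scheme.isHORS_correct hG, rfl, HORS.Scheme.order_correct G, T, h1, h2, hT⟩
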